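/- **Setting.** Let $F$ be a finite field and $m,d\ge 1$. For $f:F^m\to F$ and $x,h\in F^m$ let $P^{(f,d)}_{x,h}$ be a univariate polynomial over $F$ of degree at most $d$ with $P^{(f,d)}_{x,h}(t)=f(x+th)$ for the largest possible number of $t\in F$ (ties broken arbitrarily), given by its $d+1$ coefficients. The *polynomial-line code* $L_{m,d,F}$ has as messages the $m$-variate polynomials $f$ over $F$ of total degree at most $d$, as alphabet $\Sigma=F^{d+1}$, as positions the pairs $(x,h)\in F^m\times F^m$, and as codeword of $f$ the word $(P^{(f,d)}_{x,h})_{x,h\in F^m}$. A *family of polynomial-line codes* with exponents $c_1>1$, $c_2\ge 1$ is a sequence $L_{m,d_m,F_m}$ with $d_m=\Theta(m^{c_1})$ and $|F_m|=\Theta(d_m^{c_2})$ as $m\to\infty$. A code $C$ with positions $I$, alphabet $\Sigma$ and minimum Hamming distance $D$ is *$(p,\delta)$-locally testable* ($p\ge 1$, $\delta>0$) if there are an efficiently samplable probability space $\Omega$, functions $q_1,\dots,q_p:\Omega\to I$ and $V:\Omega\times\Sigma^p\to\{0,1\}$ such that * for every codeword $w$ and every $r\in\Omega$, $V(r,w_{q_1(r)},\dots,w_{q_p(r)})=1$;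 * for every word $w\in\Sigma^I$ with $\Pr_{r\in\Omega}[V(r,w_{q_1(r)},\dots,w_{q_p(r)})=0]<\delta$ there is a unique message $a$ such that the Hamming distance of $w$ and $C(a)$ is less than $D/2$. For a code over the field $F$, $\Omega$ is samplable in $T$ steps if a program of at most $T$ steps, each of which draws an independent uniformly random element of $F$, writes a constant, or adds or multiplies two stored elements, outputs a sample of $\Omega$ (encoded injectively as a vector over $F$). **Theorem.** For every $0<\epsilon<1/8$ there is a constant $c=c(\epsilon)>0$ such that the following hold. 1. For all $m,d\ge 1$ and every finite field $F$ with $|F|\ge cd$, the code $L_{m,d,F}$ is $(2,1/8-\epsilon)$-locally testable, with a probability space that can be sampled in $2m+1$ steps. This is achieved by the lines test: choose $x,h\in F^m$ and $t\in F$ independently and uniformly at random, let $y=x+th$, probe one point value, namely the letter $w_{(y,0)}$ of the degenerate line $\{y\}$ evaluated at $0$, and one line polynomial, namely $w_{(x,h)}$, and accept if and only if $w_{(x,h)}(t)=w_{(y,0)}(0)$. 2. Consequently, let $L_{m,d_m,F_m}$ be a family of polynomial-line codes with exponents $c_1>1$, $c_2\ge1$; if $c_2=1$, suppose that the implied constant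 in $|F_m|=\Theta(d_m)$ is large enough that $|F_m|\ge c\,d_m$ for all sufficiently large $m$. Then for all sufficiently large $m$ the code $L_{m,d_m,F_m}$ is $(2,1/8-\epsilon)$-locally testable, with a probability space that can be sampled in $2m+1$ steps. -/

import Mathlib

open Filter Asymptotics

universe u

noncomputable section

/-! ### Polynomial-line codes -/

/-- The value at `t` of the univariate polynomial whose `d + 1` coefficients are `a`. -/
def coeffEval {F : Type u} [Field F] {d : ℕ} (a : Fin (d + 1) → F) (t : F) : F :=
  ∑ i, a i * t ^ (i : ℕ)

open Classical in
/-- The number of `t ∈ F` with `P(t) = f(x + t h)`, where `P` has coefficients `a`. -/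
def agreement {F : Type u} [Field F] [Fintype F] {m d : ℕ} (f : (Fin m → F) → F)
    (x h : Fin m → F) (a : Fin (d + 1) → F) : ℕ :=
  (Finset.univ.filter fun t : F => coeffEval a t = f (x + t • h)).card

/-- The line polynomial `P^{(f,d)}_{x,h}`, given by its `d + 1` coefficients: a polynomial of
degree at most `d` with `P(t) = f(x + t h)` for the most `t ∈ F`; ties are broken arbitrarily. -/
def linePoly {F : Type u} [Field F] [Fintype F] {m : ℕ} (d : ℕ) (f : (Fin m → F) → F)
    (x h : Fin m → F) : Fin (d + 1) → F :=
  Classical.choose (Finite.exists_max (agreement (d := d) f x h))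

/-- The polynomial-line code. Messages are the `m`-variate polynomials of total degree at most `d`,
positions are the pairs `(x, h)` of points of `F^m`, the alphabet is `F^(d+1)`, and the letter of
the codeword of `f` at `(x, h)` is the line polynomial of `f` on the line `{x + t h}`. -/
def polyLineCode (m d : ℕ) (F : Type u) [Field F] [Fintype F] :
    MvPolynomial.restrictTotalDegree (Fin m) F d →
      ((Fin m → F) × (Fin m → F)) → (Fin (d + 1) → F) :=
  fun f l => linePoly d (fun y => MvPolynomial.eval y f.1) l.1 l.2

/-- `d` and `F` are the parameters of a family of polynomial-line codes with exponents
`c₁ > 1`, `c₂ ≥ 1`: `d(m) = Θ(m^c₁)` and `|F_m| = Θ(d(m)^c₂)`. -/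
structure IsPolyLineFamily (c₁ c₂ : ℝ) (d : ℕ → ℕ) (F : ℕ → Type u)
    [∀ m, Fintype (F m)] : Prop where
  one_lt_c₁ : 1 < c₁
  one_le_c₂ : 1 ≤ c₂
  degree : (fun m => (d m : ℝ)) =Θ[atTop] (fun m => (m : ℝ) ^ c₁)
  fieldSize : (fun m => (Fintype.card (F m) : ℝ)) =Θ[atTop] (fun m => (d m : ℝ) ^ c₂)

/-! ### Sampling with a step count -/

/-- One step of a randomized straight-line program over `F`. Each step writes one new field element
in front of the memory; the arguments of `add` and `mul` are memory addresses. -/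
inductive SampleStep (F : Type u) : Type u
  | draw : SampleStep F
  | const (a : F) : SampleStep F
  | add (i j : ℕ) : SampleStep F
  | mul (i j : ℕ) : SampleStep F

/-- The effect of one step on the memory; `draw` writes a uniformly random field element. -/
def SampleStep.exec {F : Type u} [Field F] [Fintype F] : SampleStep F → List F → PMF (List F)
  | .draw, s => (PMF.uniformOfFintype F).map fun a => a :: s
  | .const a, s => PMF.pure (a :: s)
  | .add i j, s => PMF.pure ((s.getD i 0 + s.getD j 0) :: s)
  | .mul i j, s => PMF.pure ((s.getD i 0 * s.getD j 0) :: s)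

/-- The distribution of the final memory of a program started with memory `s`. -/
def runSampler {F : Type u} [Field F] [Fintype F] : List (SampleStep F) → List F → PMF (List F)
  | [], s => PMF.pure s
  | c :: cs, s => (c.exec s).bind (runSampler cs)

/-- The probability space `(Ω, μ)` can be sampled in `T` steps over `F`: its points, encoded
injectively as vectors over `F`, are distributed as the contents of some fixed memory cells after
a run of a program with at most `T` steps. -/
def IsSampledIn (F : Type u) [Field F] [Fintype F] (T : ℕ) {Ω : Type u} (μ : PMF Ω) : Prop :=
  ∃ (prog : List (SampleStep F)) (s : ℕ) (out : Fin s → ℕ) (e : Ω → Fin s → F),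
    prog.length ≤ T ∧ Function.Injective e ∧
      μ.map e = (runSampler prog []).map fun mem j => mem.getD (out j) 0

/-! ### Local tests -/

/-- The smallest Hamming distance between the codewords of two different messages. -/
def minDist {M ι A : Type*} [Fintype ι] [DecidableEq A] (C : M → ι → A) : ℕ :=
  sInf {k | ∃ a b, a ≠ b ∧ hammingDist (C a) (C b) = k}

/-- A test that probes `p` letters of a word: a probability space, `p` query functions and a
boolean decision function. -/
structure LocalTest (p : ℕ) (ι A : Type u) where
  Ω : Type u
  μ : PMF Ω
  query : Fin p → Ω → ι
  verdict : Ω → (Fin p → A) → Bool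

/-- The verdict of a test on the word `w` when the random outcome is `r`. -/
def LocalTest.run {p : ℕ} {ι A : Type u} (t : LocalTest p ι A) (w : ι → A) (r : t.Ω) : Bool :=
  t.verdict r fun i => w (t.query i r)

/-- The probability that a test rejects the word `w`. -/
def LocalTest.rejectProb {p : ℕ} {ι A : Type u} (t : LocalTest p ι A) (w : ι → A) : ENNReal :=
  (t.μ.map (t.run w)) false

open Classical in
/-- The test `t` always accepts codewords of `C`, and every word that it rejects with probability
less than `δ` is within less than half the minimum distance of exactly one codeword. -/
structure LocalTest.Tests {p : ℕ} {M ι A : Type u} [Fintype ι] (t : LocalTest p ι A)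
    (C : M → ι → A) (δ : ℝ) : Prop where
  complete : ∀ (a : M) (r : t.Ω), t.run (C a) r = true
  sound : ∀ w : ι → A, t.rejectProb w < ENNReal.ofReal δ →
    ∃! a : M, (hammingDist w (C a) : ℝ) < (minDist C : ℝ) / 2

/-- `C` is `(p, δ)`-locally testable, by a test whose probability space can be sampled in `T` steps
over the field `F`. -/
def IsLocallyTestable (F : Type u) [Field F] [Fintype F] {M ι A : Type u} [Fintype ι]
    (p : ℕ) (δ : ℝ) (T : ℕ) (C : M → ι → A) : Prop :=
  0 < p ∧ 0 < δ ∧ ∃ t : LocalTest p ι A, IsSampledIn F T t.μ ∧ t.Tests C δ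

open Classical in
/-- The lines test: for uniformly random `x, h ∈ F^m` and `t ∈ F`, probe the value at the point
`y = x + t h`, that is, the letter of the degenerate line `(y, 0) = {y}`, evaluated at `0`, and
the line polynomial at `(x, h)`; accept if the latter takes the former value at `t`. -/
def linesTest (m d : ℕ) (F : Type u) [Field F] [Fintype F] :
    LocalTest 2 ((Fin m → F) × (Fin m → F)) (Fin (d + 1) → F) where
  Ω := (Fin m → F) × (Fin m → F) × F
  μ := PMF.uniformOfFintype _
  query := fun i r => if i = 0 then (r.1 + r.2.2 • r.2.1, 0) else (r.1, r.2.1)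
  verdict := fun r a => decide (coeffEval (a 1) r.2.2 = coeffEval (a 0) 0)

end

/-! Read a word `w` as point values `f y = w_{(y,0)}(0)` together with a table of line polynomials.
Replacing the table by a best fit `G` to `f` on every line only lowers the rejection probability, so
`G` and `f` disagree on less than a `1/8 - ε` fraction of the pairs (point, direction).

The core is a bivariate statement (`exists_bivariate`). Suppose row and column polynomials on the
grid `F × F` disagree on a fraction below `1/4`. An error locator `E` of degree below `|F|/2` in
each variable vanishes on the disagreements, so `E` times the table is a polynomial `N`, and
slicewise divisibility of `N` by `E` forces `E ∣ N`. The quotient matches all but few rows and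
columns. It is applied to random doubly ruled surfaces `u + s v + t (u' + s v')`. By Chebyshev each
of the two rulings disagrees with `f` on little more than its expected fraction; two times `1/8 - ε`
stays below `1/4`, which is where `1/8` comes from. Hence two line polynomials through a random
point agree there except with probability `O(1/(ε² |F|))` (`IsBestFit.sum_cnt_ne_le`).

So the most popular value `f₁ y` of the lines through `y` is consistent with the table up to a tiny
error. For so small an error self-correction works (`IsBestFit.exists_corrected`): through every
point almost all line polynomials of a best fit to `f₁` share one value `g x`, and surfaces
containing a given line show that `g` is a polynomial of degree at most `d` on that line. Such a `g`
is a polynomial of total degree at most `d` (`exists_mvPolynomial_of_line`), and `f` differs from it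
on at most `1/8` of the points.

Finally `w` is within relative distance about `1/8 + 1/8` of the codeword of `g`, while by
Schwartz–Zippel half the relative minimum distance is close to `1/2`. -/

namespace PolyLine

open Polynomial Polynomial.Bivariate

/-! ### Bivariate polynomials on a grid -/

section Bivariate

variable {F : Type u} [Field F]

/-- The function `φ` is given by a univariate polynomial of degree at most `d`. -/
def IsPolyFun (d : ℕ) (φ : F → F) : Prop :=
  ∃ p : F[X], p.natDegree ≤ d ∧ ∀ t, p.eval t = φ t

theorem coeff_coeff_swap (E : F[X][Y]) (i j : ℕ) :
    ((swap E).coeff i).coeff j = (E.coeff j).coeff i := by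
  induction E using Polynomial.induction_on' with
  | add p q hp hq => simp only [map_add, coeff_add, hp, hq]
  | monomial n a =>
    induction a using Polynomial.induction_on' with
    | add p q hp hq => simp only [map_add, coeff_add, hp, hq]
    | monomial m r =>
      rw [swap_monomial_monomial]
      simp only [coeff_monomial]
      by_cases h1 : m = i <;> by_cases h2 : n = j <;> simp [h1, h2, coeff_monomial]

/-- In `F[X][Y]` the `natDegree` is the degree in the second variable `Y`; `(swap E).natDegree`
serves throughout as the degree in the first variable `X`. -/
theorem natDegree_swap_le_iff {E : F[X][Y]} {b : ℕ} :
    (swap E).natDegree ≤ b ↔ ∀ j, (E.coeff j).natDegree ≤ b := by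
  simp only [natDegree_le_iff_coeff_eq_zero]
  constructor
  · intro h j i hi
    rw [← coeff_coeff_swap, h i hi, coeff_zero]
  · intro h i hi
    ext j
    rw [coeff_coeff_swap, h j i hi, coeff_zero]

/-- The polynomial in the second variable obtained by fixing the first one. -/
noncomputable def slice (E : F[X][Y]) (s : F) : F[X] := E.map (evalRingHom s)

theorem slice_mul (E N : F[X][Y]) (s : F) : slice (E * N) s = slice E s * slice N s :=
  Polynomial.map_mul _

theorem slice_add (E N : F[X][Y]) (s : F) : slice (E + N) s = slice E s + slice N s :=
  Polynomial.map_add _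

theorem eval_slice (E : F[X][Y]) (s t : F) : (slice E s).eval t = E.evalEval s t :=
  map_evalRingHom_eval s t E

theorem evalEval_swap (E : F[X][Y]) (s t : F) : (swap E).evalEval s t = E.evalEval t s := by
  have := aevalAeval_swap (A := F) s t E
  rwa [coe_aevalAeval_eq_evalEval, coe_aevalAeval_eq_evalEval] at this

theorem natDegree_slice_le (E : F[X][Y]) (s : F) : (slice E s).natDegree ≤ E.natDegree :=
  natDegree_map_le

/-- A bivariate polynomial with more vanishing slices than its degree in the first variable
is zero. -/
theorem eq_zero_of_slice_eq_zero {E : F[X][Y]} (I : Finset F)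
    (hI : (swap E).natDegree < I.card) (h : ∀ s ∈ I, slice E s = 0) : E = 0 := by
  ext1 j
  rw [coeff_zero]
  refine eq_zero_of_natDegree_lt_card_of_eval_eq_zero' _ I (fun s hs => ?_)
    ((natDegree_swap_le_iff.1 le_rfl j).trans_lt hI)
  have := congrArg (fun p => p.coeff j) (h s hs)
  simpa [slice, coeff_map] using this

/-- The bivariate polynomial with a given array of coefficients. -/
noncomputable def ofArray (n k : ℕ) : (Fin n → Fin k → F) →ₗ[F] F[X][Y] where
  toFun f := ∑ j : Fin n, ∑ i : Fin k, monomial (j : ℕ) (monomial (i : ℕ) (f j i))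
  map_add' f g := by simp [Finset.sum_add_distrib]
  map_smul' c f := by simp [Finset.smul_sum, smul_monomial]

theorem coeff_coeff_ofArray {n k : ℕ} (f : Fin n → Fin k → F) (j i : ℕ) :
    ((ofArray n k f).coeff j).coeff i =
      if h : j < n ∧ i < k then f ⟨j, h.1⟩ ⟨i, h.2⟩ else 0 := by
  simp only [ofArray, LinearMap.coe_mk, AddHom.coe_mk, finsetSum_coeff, coeff_monomial]
  split_ifs with h
  · rw [Finset.sum_eq_single ⟨j, h.1⟩, Finset.sum_eq_single ⟨i, h.2⟩]
    · simp
    · intro b _ hb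
      have : (b : ℕ) ≠ i := fun h => hb (Fin.ext h)
      simp [this, coeff_monomial]
    · simp
    · intro b _ hb
      have : (b : ℕ) ≠ j := fun h => hb (Fin.ext h)
      simp [this]
    · simp
  · refine Finset.sum_eq_zero fun b _ => Finset.sum_eq_zero fun a _ => ?_
    by_cases h1 : (b : ℕ) = j
    · have : (a : ℕ) ≠ i := fun h2 => h ⟨h1 ▸ b.2, h2 ▸ a.2⟩
      simp [h1, coeff_monomial, this]
    · simp [h1]

theorem ofArray_injective (n k : ℕ) : Function.Injective (ofArray (F := F) n k) := by
  intro f g h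
  funext j i
  have := congrArg (fun p => (p.coeff j).coeff i) h
  simpa [coeff_coeff_ofArray] using this

theorem degree_ofArray_lt {n k : ℕ} (f : Fin n → Fin k → F) :
    (ofArray n k f).degree < n := by
  rw [degree_lt_iff_coeff_zero]
  intro m hm
  ext i
  rw [coeff_coeff_ofArray, dif_neg (by omega), coeff_zero]

theorem degree_swap_ofArray_lt {n k : ℕ} (f : Fin n → Fin k → F) :
    (swap (ofArray n k f)).degree < k := by
  rw [degree_lt_iff_coeff_zero]
  intro m hm
  ext i
  rw [coeff_coeff_swap, coeff_coeff_ofArray, dif_neg (by omega), coeff_zero]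

/-- The error locator exists by counting: `(e + 1) ^ 2` free coefficients against one linear
condition per point of `S`. -/
theorem exists_ne_zero_vanishing (e : ℕ) (S : Finset (F × F)) (hS : S.card < (e + 1) ^ 2) :
    ∃ E : F[X][Y], E ≠ 0 ∧ E.natDegree ≤ e ∧ (swap E).natDegree ≤ e ∧
      ∀ x ∈ S, E.evalEval x.1 x.2 = 0 := by
  classical
  let Φ : (Fin (e + 1) → Fin (e + 1) → F) →ₗ[F] (S → F) :=
    { toFun := fun f x => (ofArray _ _ f).evalEval x.1.1 x.1.2
      map_add' := fun f g => by ext x; simp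
      map_smul' := fun c f => by ext x; simp }
  have hlt : Module.finrank F (S → F) < Module.finrank F (Fin (e + 1) → Fin (e + 1) → F) := by
    simp only [Module.finrank_pi, Module.finrank_pi_fintype]
    simpa [sq] using hS
  obtain ⟨f, hf, hf0⟩ := Submodule.exists_mem_ne_zero_of_ne_bot (Φ.ker_ne_bot_of_finrank_lt hlt)
  have hE : ofArray _ _ f ≠ 0 := fun h => hf0 (ofArray_injective _ _ (by simpa using h))
  refine ⟨ofArray _ _ f, hE,
    Nat.le_of_lt_succ ((natDegree_lt_iff_degree_lt hE).2 (degree_ofArray_lt f)),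
    Nat.le_of_lt_succ ((natDegree_lt_iff_degree_lt (by simpa using hE)).2
      (degree_swap_ofArray_lt f)), ?_⟩
  intro x hx
  exact congrFun (LinearMap.mem_ker.1 hf) ⟨x, hx⟩

/-- Lagrange interpolation of the rows in the second variable gives the right columns and the degree
in the first variable. The degree in the second drops to `k` because the coefficient of each higher
power vanishes at all of `F` and has degree at most `l < |F|`. -/
theorem exists_interpolant [Fintype F] {k l : ℕ} (hk : k < Fintype.card F)
    (hl : l < Fintype.card F) (Cp Rp : F → F[X]) (hC : ∀ s, (Cp s).natDegree ≤ k)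
    (hR : ∀ t, (Rp t).natDegree ≤ l) (h : ∀ s t, (Cp s).eval t = (Rp t).eval s) :
    ∃ N : F[X][Y], N.natDegree ≤ k ∧ (swap N).natDegree ≤ l ∧ ∀ s, slice N s = Cp s := by
  classical
  let Lb : F → F[X] := fun t => Lagrange.basis Finset.univ id t
  let N : F[X][Y] := ∑ t, C (Rp t) * (Lb t).map C
  have hcoeff : ∀ j, N.coeff j = ∑ t, Rp t * C ((Lb t).coeff j) := fun j => by
    simp [N, finsetSum_coeff, coeff_C_mul, coeff_map]
  have hs : ∀ s, slice N s = Cp s := fun s => by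
    have h1 : slice N s = ∑ t, C ((Cp s).eval t) * Lb t := by
      simp only [slice, N, Polynomial.map_sum, Polynomial.map_mul, map_C, Polynomial.map_map, h]
      refine Finset.sum_congr rfl fun t _ => ?_
      congr 1
      convert Polynomial.map_id
      ext
      simp
    rw [h1]
    symm
    have := Lagrange.eq_interpolate (s := (Finset.univ : Finset F)) (v := id) (f := Cp s)
      Function.injective_id.injOn
      (degree_le_natDegree.trans_lt (by exact_mod_cast (hC s).trans_lt hk))
    conv_lhs => rw [this, Lagrange.interpolate_apply]
    rfl
  have hsw : ∀ j, (N.coeff j).natDegree ≤ l := fun j => by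
    rw [hcoeff]
    refine natDegree_sum_le_of_forall_le _ _ fun t _ => ?_
    exact (natDegree_mul_C_le _ _).trans (hR t)
  refine ⟨N, ?_, natDegree_swap_le_iff.2 hsw, hs⟩
  rw [natDegree_le_iff_coeff_eq_zero]
  intro j hj
  refine eq_zero_of_natDegree_lt_card_of_eval_eq_zero' _ Finset.univ (fun s _ => ?_)
    ((hsw j).trans_lt hl)
  have := congrArg (fun p => p.coeff j) (hs s)
  simp only [slice, coeff_map, coe_evalRingHom] at this
  rw [this, coeff_eq_zero_of_natDegree_lt ((hC s).trans_lt hj)]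

/-- If `E` and `N` are coprime and `E` divides `N` on many slices with quotients of degree at most
`d`, then `E` is constant. -/
theorem natDegree_eq_zero_of_slice_dvd {E N : F[X][Y]} (hE : E ≠ 0)
    (hrel : ∀ D, D ∣ E → D ∣ N → IsUnit D) {d : ℕ}
    (hNs : (swap N).natDegree ≤ (swap E).natDegree + d) (I : Finset F) (Cp : F → F[X])
    (hCp : ∀ s ∈ I, (Cp s).natDegree ≤ d) (hdvd : ∀ s ∈ I, slice N s = slice E s * Cp s)
    (hab : (swap E).natDegree ≤ E.natDegree) (hI : 2 * ((swap E).natDegree + d) < I.card) :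
    E.natDegree = 0 := by
  classical
  set a := E.natDegree
  set b := (swap E).natDegree with hb
  by_contra ha
  -- Seek a nonzero pair `(A, B)` with `A * Cp + B = 0` on every slice in `I`, where `A` has degrees
  -- below `(α, a)` and `B` below `(α + d, a + d)` in the first and second variable. The choice of
  -- `α` makes `A * N + B * E` have degree below `|I|` in the first variable.
  obtain ⟨α, hα⟩ : ∃ α, I.card = α + b + d := ⟨I.card - b - d, by omega⟩
  let Φ : ((Fin a → Fin α → F) × (Fin (a + d) → Fin (α + d) → F)) →ₗ[F]
      (I → Fin (a + d) → F) :=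
    { toFun := fun f s j => (slice (ofArray _ _ f.1) s.1 * Cp s.1 +
        slice (ofArray _ _ f.2) s.1).coeff j
      map_add' := fun f g => by
        funext s j
        simp only [Prod.fst_add, Prod.snd_add, map_add, slice_add, add_mul, coeff_add, Pi.add_apply]
        ring
      map_smul' := fun c f => by
        have hsm : ∀ (P : F[X][Y]) (s : F), slice (c • P) s = c • slice P s := fun P s => by
          ext j
          simp [slice, coeff_map]
        funext s j
        simp only [Prod.smul_fst, Prod.smul_snd, map_smul, hsm, smul_mul_assoc, coeff_add,
          coeff_smul, Pi.smul_apply, RingHom.id_apply, smul_add] }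
  -- Unknowns exceed equations by `a * α - b * (a + d)`. This is positive since `α > b + d` and `b ≤
  -- a`.
  have hlt : Module.finrank F (I → Fin (a + d) → F) < Module.finrank F
      ((Fin a → Fin α → F) × (Fin (a + d) → Fin (α + d) → F)) := by
    rw [Module.finrank_prod]
    simp only [Module.finrank_pi_fintype, Module.finrank_self, mul_one, Finset.sum_const, Finset.card_univ,
      Fintype.card_fin, Fintype.card_coe, smul_eq_mul, hα]
    have h1 : b + d < α := by omega
    have h2 : 1 ≤ a := by omega
    have h3 : b * (a + d) < a * α := by nlinarith
    nlinarith
  obtain ⟨⟨f, g⟩, hf, hf0⟩ :=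
    Submodule.exists_mem_ne_zero_of_ne_bot (Φ.ker_ne_bot_of_finrank_lt hlt)
  set A := ofArray _ _ f with hA
  set B := ofArray _ _ g with hB
  have hzero : ∀ s ∈ I, slice A s * Cp s + slice B s = 0 := by
    intro s hs
    have h1 : (slice A s * Cp s + slice B s).degree < (a + d : ℕ) := by
      have hA' : (slice A s).degree < a := degree_map_le.trans_lt (degree_ofArray_lt f)
      have hB' : (slice B s).degree < (a + d : ℕ) := degree_map_le.trans_lt (degree_ofArray_lt g)
      refine (degree_add_le _ _).trans_lt (max_lt ?_ hB')
      by_cases h0 : slice A s = 0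
      · rw [h0, zero_mul, degree_zero]
        exact WithBot.bot_lt_coe _
      · refine degree_mul_le _ _ |>.trans_lt ?_
        rw [degree_eq_natDegree h0] at hA' ⊢
        calc ((slice A s).natDegree : WithBot ℕ) + (Cp s).degree
            ≤ (slice A s).natDegree + (d : WithBot ℕ) := by
              gcongr
              exact degree_le_of_natDegree_le (hCp s hs)
          _ < (a + d : ℕ) := by
              have : (slice A s).natDegree < a := by exact_mod_cast hA'
              exact_mod_cast Nat.add_lt_add_right this d
    ext j
    rw [coeff_zero]
    by_cases hj : j < a + d
    · exact congrFun (congrFun (LinearMap.mem_ker.1 hf) ⟨s, hs⟩) ⟨j, hj⟩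
    · exact (degree_lt_iff_coeff_zero _ _).1 h1 j (by omega)
  have hdegA : (swap (A * N + B * E)).natDegree < I.card := by
    have hI0 : 0 < I.card := by omega
    rw [map_add, map_mul, map_mul]
    refine (natDegree_add_le _ _).trans_lt (max_lt ?_ ?_)
    · by_cases h0 : A = 0
      · simpa [h0] using hI0
      · have := (natDegree_lt_iff_degree_lt (p := swap A) (by simpa using h0)).2
          (degree_swap_ofArray_lt f)
        refine natDegree_mul_le.trans_lt ?_
        omega
    · by_cases h0 : B = 0
      · simpa [h0] using hI0
      · have := (natDegree_lt_iff_degree_lt (p := swap B) (by simpa using h0)).2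
          (degree_swap_ofArray_lt g)
        refine natDegree_mul_le.trans_lt ?_
        omega
  have hzero' : A * N + B * E = 0 := by
    refine eq_zero_of_slice_eq_zero I hdegA fun s hs => ?_
    rw [slice_add, slice_mul, slice_mul, hdvd s hs]
    linear_combination slice E s * hzero s hs
  -- From `A * N = -B * E` and coprimality, `E ∣ A`; but `A` has smaller degree than `E` in the
  -- second variable, so `A = 0` and then `B = 0`.
  have hrp : IsRelPrime E N := fun D h1 h2 => hrel D h1 h2
  have hEA : E ∣ A := by
    refine hrp.dvd_of_dvd_mul_right ⟨-B, ?_⟩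
    linear_combination hzero'
  have hA0 : A = 0 := by
    refine eq_zero_of_dvd_of_degree_lt hEA ?_
    rw [degree_eq_natDegree hE]
    exact degree_ofArray_lt f
  have hB0 : B = 0 := by
    rw [hA0, zero_mul, zero_add] at hzero'
    exact (mul_eq_zero.1 hzero').resolve_right hE
  refine hf0 (Prod.ext (ofArray_injective _ _ ?_) (ofArray_injective _ _ ?_))
  · simpa using hA0
  · simpa using hB0

theorem card_slice_eq_zero_le {H : F[X][Y]} (hH : H ≠ 0) (I : Finset F)
    (h : ∀ s ∈ I, slice H s = 0) : I.card ≤ (swap H).natDegree := by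
  by_contra hlt
  exact hH (eq_zero_of_slice_eq_zero I (not_le.1 hlt) h)

/-- Divisibility of all slices in both directions, with quotients of low degree, implies
divisibility. -/
theorem exists_quotient [Fintype F] {E N : F[X][Y]} (hE : E ≠ 0) {d : ℕ} (Cp Rp : F → F[X])
    (hCp : ∀ s, (Cp s).natDegree ≤ d) (hRp : ∀ t, (Rp t).natDegree ≤ d)
    (hN : N.natDegree ≤ E.natDegree + d) (hNs : (swap N).natDegree ≤ (swap E).natDegree + d)
    (hC : ∀ s, slice N s = slice E s * Cp s)
    (hR : ∀ t, slice (swap N) t = slice (swap E) t * Rp t)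
    (hdeg : 2 * (E.natDegree + d) < Fintype.card F)
    (hdegs : 2 * ((swap E).natDegree + d) < Fintype.card F) :
    ∃ Q : F[X][Y], N = E * Q ∧ Q.natDegree ≤ d ∧ (swap Q).natDegree ≤ d := by
  classical
  by_cases hN0 : N = 0
  · exact ⟨0, by simp [hN0]⟩
  obtain ⟨E', N', H, hrel, hHE, hHN⟩ :=
    UniqueFactorizationMonoid.exists_reduced_factors E hE N
  have hH0 : H ≠ 0 := by rintro rfl; exact hE (by simpa using hHE.symm)
  have hE'0 : E' ≠ 0 := by rintro rfl; exact hE (by simpa using hHE.symm)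
  have hN'0 : N' ≠ 0 := by rintro rfl; exact hN0 (by simpa using hHN.symm)
  have hsw : ∀ P : F[X][Y], P ≠ 0 → swap P ≠ 0 := fun P h => by simpa using h
  -- The common factor `H` can be cancelled on every slice where it does not vanish. The slices lost
  -- number at most its degree in the first variable, and that of `E'` is smaller than that of `E`
  -- by the same amount, so the size condition survives.
  have key : ∀ (E N E' N' H : F[X][Y]) (Cp : F → F[X]), E' ≠ 0 → N' ≠ 0 → H ≠ 0 →
      (∀ ⦃D⦄, D ∣ E' → D ∣ N' → IsUnit D) → H * E' = E → H * N' = N →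
      (∀ s, (Cp s).natDegree ≤ d) → (swap N).natDegree ≤ (swap E).natDegree + d →
      (∀ s, slice N s = slice E s * Cp s) → 2 * ((swap E).natDegree + d) < Fintype.card F →
      (swap E').natDegree ≤ E'.natDegree → E'.natDegree = 0 := by
    intro E N E' N' H Cp hE'0 hN'0 hH0 hrel hHE hHN hCp hNs hC hdegs hle
    have h1 : (swap E).natDegree = (swap H).natDegree + (swap E').natDegree := by
      rw [← hHE, map_mul, natDegree_mul (hsw _ hH0) (hsw _ hE'0)]
    have h2 : (swap N).natDegree = (swap H).natDegree + (swap N').natDegree := by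
      rw [← hHN, map_mul, natDegree_mul (hsw _ hH0) (hsw _ hN'0)]
    have h3 := card_slice_eq_zero_le hH0 (Finset.univ.filter fun s => slice H s = 0)
      (fun s hs => (Finset.mem_filter.1 hs).2)
    have h4 := Finset.card_filter_add_card_filter_not (s := (Finset.univ : Finset F))
      (fun s => slice H s = 0)
    rw [Finset.card_univ] at h4
    refine natDegree_eq_zero_of_slice_dvd (d := d) hE'0 (fun D h h' => hrel h h') (by omega)
      (Finset.univ.filter fun s => ¬ slice H s = 0) Cp (fun s _ => hCp s) (fun s hs => ?_) hle
      (by omega)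
    have h5 := hC s
    rw [← hHE, ← hHN, slice_mul, slice_mul, mul_assoc] at h5
    exact mul_left_cancel₀ (Finset.mem_filter.1 hs).2 h5
  -- Killing the larger of the two degrees of `E'` kills both; the other case is the same after
  -- exchanging the variables.
  have hboth : E'.natDegree = 0 ∧ (swap E').natDegree = 0 := by
    rcases le_total (swap E').natDegree E'.natDegree with hle | hle
    · have := key E N E' N' H Cp hE'0 hN'0 hH0 hrel hHE hHN hCp hNs hC hdegs hle
      omega
    · have := key (swap E) (swap N) (swap E') (swap N') (swap H) Rp (hsw _ hE'0) (hsw _ hN'0)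
        (hsw _ hH0) (fun D h h' => by
          have := hrel (d := swap D) (by simpa [swap_swap_apply] using map_dvd swap h)
            (by simpa [swap_swap_apply] using map_dvd swap h')
          simpa [swap_swap_apply] using this.map (swap (R := F)))
        (by rw [← map_mul, hHE]) (by rw [← map_mul, hHN]) hRp
        (by simpa only [swap_swap_apply] using hN) hR
        (by simpa only [swap_swap_apply] using hdeg) (by simpa only [swap_swap_apply] using hle)
      omega
  obtain ⟨r, hr⟩ : ∃ r : F, E' = C (C r) := by
    rw [eq_C_of_natDegree_eq_zero hboth.1]
    have := natDegree_swap_le_iff.1 hboth.2.le 0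
    rw [Nat.le_zero] at this
    exact ⟨_, congrArg C (eq_C_of_natDegree_eq_zero this)⟩
  have hr0 : r ≠ 0 := by rintro rfl; exact hE'0 (by simpa using hr)
  have hinv : E' * C (C r⁻¹) = 1 := by
    rw [hr, ← C_mul, ← C_mul, mul_inv_cancel₀ hr0, C_1, C_1]
  have hNQ : N = E * (C (C r⁻¹) * N') := by
    rw [← hHE, ← hHN]
    linear_combination (-H * N') * hinv
  have hQ0 : C (C r⁻¹) * N' ≠ 0 := by rintro h; exact hN0 (by simpa [h] using hNQ)
  refine ⟨_, hNQ, ?_, ?_⟩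
  · have := congrArg natDegree hNQ
    rw [natDegree_mul hE hQ0] at this
    omega
  · have := congrArg (fun P => (swap P).natDegree) hNQ
    rw [map_mul, natDegree_mul (hsw _ hE) (hsw _ hQ0)] at this
    omega

theorem eq_of_card_lt_of_eval_eq [Fintype F] [DecidableEq F] {d : ℕ} {p r : F[X]}
    (hp : p.natDegree ≤ d) (hr : r.natDegree ≤ d)
    (h : d < (Finset.univ.filter fun t => p.eval t = r.eval t).card) : p = r := by
  rw [← sub_eq_zero]
  refine eq_zero_of_natDegree_lt_card_of_eval_eq_zero' _ _ (fun t ht => ?_)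
    (((natDegree_sub_le _ _).trans (max_le hp hr)).trans_lt h)
  simp [(Finset.mem_filter.1 ht).2]

theorem IsPolyFun.eq_of_card_lt [Fintype F] [DecidableEq F] {d : ℕ} {φ ψ : F → F}
    (hφ : IsPolyFun d φ) (hψ : IsPolyFun d ψ)
    (h : d < (Finset.univ.filter fun t => φ t = ψ t).card) : φ = ψ := by
  obtain ⟨p, hp, hpφ⟩ := hφ
  obtain ⟨r, hr, hrψ⟩ := hψ
  simp only [← hpφ, ← hrψ] at h
  have := eq_of_card_lt_of_eval_eq hp hr h
  funext t
  rw [← hpφ, ← hrψ, this]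

/-- Rows and columns of low degree that agree on most of the grid come from a bivariate
polynomial; its disagreement with the columns is controlled by the degree of the error locator. -/
theorem exists_bivariate_of_agree [Fintype F] [DecidableEq F] {d e : ℕ} {Cf Rf : F → F → F}
    (hC : ∀ s, IsPolyFun d (Cf s)) (hR : ∀ t, IsPolyFun d (fun s => Rf s t))
    (hK : (Finset.univ.filter fun x : F × F => Cf x.1 x.2 ≠ Rf x.1 x.2).card < (e + 1) ^ 2)
    (hed : 2 * (e + d) < Fintype.card F) :
    ∃ Q : F → F → F, (∀ s, IsPolyFun d (Q s)) ∧ (∀ t, IsPolyFun d (fun s => Q s t)) ∧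
      (Finset.univ.filter fun s => Cf s ≠ Q s).card ≤ e ∧
      (Finset.univ.filter fun t => (fun s => Rf s t) ≠ fun s => Q s t).card ≤ e := by
  choose Cp hCp hCe using hC
  choose Rp hRp hRe using hR
  obtain ⟨E, hE, hEe, hEse, hEv⟩ := exists_ne_zero_vanishing e _ hK
  -- Multiplying by the locator erases all disagreements, so rows and columns become compatible on
  -- the whole grid.
  have hagree : ∀ s t, E.evalEval s t * Cf s t = E.evalEval s t * Rf s t := fun s t => by
    by_cases h : Cf s t = Rf s t
    · rw [h]
    · rw [hEv (s, t) (by simpa using h), zero_mul, zero_mul]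
  obtain ⟨N, hN, hNs, hNsl⟩ := exists_interpolant (k := E.natDegree + d)
    (l := (swap E).natDegree + d) (by omega) (by omega) (fun s => slice E s * Cp s)
    (fun t => slice (swap E) t * Rp t)
    (fun s => natDegree_mul_le.trans (add_le_add (natDegree_slice_le _ _) (hCp s)))
    (fun t => natDegree_mul_le.trans (add_le_add (natDegree_slice_le _ _) (hRp t)))
    (fun s t => by
      simp only [eval_mul, eval_slice, hCe, hRe, evalEval_swap]
      exact hagree s t)
  have hNr : ∀ t, slice (swap N) t = slice (swap E) t * Rp t := fun t => by
    refine eq_of_card_lt_of_eval_eq (d := (swap E).natDegree + d)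
      ((natDegree_slice_le _ _).trans hNs)
      (natDegree_mul_le.trans (add_le_add (natDegree_slice_le _ _) (hRp t))) ?_
    rw [Finset.filter_true_of_mem, Finset.card_univ]
    · omega
    · intro s _
      rw [eval_slice, evalEval_swap, ← eval_slice, hNsl, eval_mul, eval_mul, eval_slice,
        eval_slice, evalEval_swap, hCe, hRe]
      exact hagree s t
  obtain ⟨Q, hQ, hQd, hQs⟩ := exists_quotient hE Cp Rp hCp hRp hN hNs hNsl hNr (by omega)
    (by omega)
  refine ⟨fun s t => Q.evalEval s t,
    fun s => ⟨slice Q s, (natDegree_slice_le _ _).trans hQd, fun t => eval_slice _ _ _⟩,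
    fun t => ⟨slice (swap Q) t, (natDegree_slice_le _ _).trans hQs, fun s => by
      rw [eval_slice, evalEval_swap]⟩, ?_, ?_⟩
  -- Where the slice of `E` is nonzero it cancels from `N = E * Q`, so a bad column lies over a
  -- vanishing slice of `E`.
  · refine (card_slice_eq_zero_le hE _ fun s hs => ?_).trans hEse
    by_contra h0
    refine (Finset.mem_filter.1 hs).2 (funext fun t => ?_)
    have h1 := hNsl s
    rw [hQ, slice_mul] at h1
    rw [← hCe, ← mul_left_cancel₀ h0 h1, eval_slice]
  · refine (card_slice_eq_zero_le (H := swap E) (by simpa using hE) _ fun t ht => ?_).trans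
      (by simpa only [swap_swap_apply] using hEe)
    by_contra h0
    refine (Finset.mem_filter.1 ht).2 (funext fun s => ?_)
    have h1 := hNr t
    rw [hQ, map_mul, slice_mul] at h1
    refine (hRe t s).symm.trans ?_
    rw [← mul_left_cancel₀ h0 h1, eval_slice, evalEval_swap]

/-- Rows and columns of low degree that agree on most of the grid come from a bivariate
polynomial, up to few rows and columns. -/
theorem exists_bivariate [Fintype F] [DecidableEq F] {d e K : ℕ} {Cf Rf : F → F → F}
    (hC : ∀ s, IsPolyFun d (Cf s)) (hR : ∀ t, IsPolyFun d (fun s => Rf s t))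
    (hK : (Finset.univ.filter fun x : F × F => Cf x.1 x.2 ≠ Rf x.1 x.2).card ≤ K)
    (hKe : K < (e + 1) ^ 2) (hed : 2 * (e + d) < Fintype.card F) :
    ∃ Q : F → F → F, (∀ s, IsPolyFun d (Q s)) ∧ (∀ t, IsPolyFun d (fun s => Q s t)) ∧
      (Finset.univ.filter fun s => Cf s ≠ Q s).card * Fintype.card F ≤ K + d * Fintype.card F ∧
      (Finset.univ.filter fun t => (fun s => Rf s t) ≠ fun s => Q s t).card * Fintype.card F ≤
        K + d * Fintype.card F := by
  obtain ⟨Q, hQ1, hQ2, hc, hr⟩ := exists_bivariate_of_agree hC hR (hK.trans_lt hKe) hed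
  refine ⟨Q, hQ1, hQ2, ?_⟩
  set q := Fintype.card F
  set bc := Finset.univ.filter fun s => Cf s ≠ Q s with hbc
  set br := Finset.univ.filter fun t => (fun s => Rf s t) ≠ fun s => Q s t with hbr
  -- A bad column meets `Q` at most `d` times, and on a good row `Rf = Q`; its remaining points on
  -- good rows are therefore disagreements of `Cf` with `Rf`.
  have hcol : ∀ s ∈ bc, q ≤ (brᶜ.filter fun t => Cf s t ≠ Rf s t).card + br.card + d := by
    intro s hs
    have h1 : (Finset.univ.filter fun t => Cf s t = Q s t).card ≤ d := by
      by_contra h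
      exact (Finset.mem_filter.1 hs).2 ((hC s).eq_of_card_lt (hQ1 s) (not_le.1 h))
    have h2 : (Finset.univ : Finset F) ⊆ (brᶜ.filter fun t => Cf s t ≠ Rf s t) ∪ br ∪
        (Finset.univ.filter fun t => Cf s t = Q s t) := by
      intro t _
      simp only [Finset.mem_union, Finset.mem_filter, Finset.mem_univ, true_and,
        Finset.mem_compl]
      by_cases ht : t ∈ br
      · simp [ht]
      · have h3 : (fun s => Rf s t) = fun s => Q s t := by simpa [hbr] using ht
        have h4 : Rf s t = Q s t := congrFun h3 s
        by_cases h5 : Cf s t = Q s t <;> simp [ht, h4, h5]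
    calc q = (Finset.univ : Finset F).card := Finset.card_univ.symm
      _ ≤ _ := Finset.card_le_card h2
      _ ≤ _ := (Finset.card_union_le _ _).trans
        (add_le_add (Finset.card_union_le _ _) h1)
  have hrow : ∀ t ∈ br, q ≤ (bcᶜ.filter fun s => Cf s t ≠ Rf s t).card + bc.card + d := by
    intro t ht
    have h1 : (Finset.univ.filter fun s => Rf s t = Q s t).card ≤ d := by
      by_contra h
      exact (Finset.mem_filter.1 ht).2 ((hR t).eq_of_card_lt (hQ2 t) (not_le.1 h))
    have h2 : (Finset.univ : Finset F) ⊆ (bcᶜ.filter fun s => Cf s t ≠ Rf s t) ∪ bc ∪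
        (Finset.univ.filter fun s => Rf s t = Q s t) := by
      intro s _
      simp only [Finset.mem_union, Finset.mem_filter, Finset.mem_univ, true_and,
        Finset.mem_compl]
      by_cases hs : s ∈ bc
      · simp [hs]
      · have h3 : Cf s = Q s := by simpa [hbc] using hs
        by_cases h5 : Rf s t = Q s t
        · simp [h5]
        · simp [hs, h3, Ne.symm h5]
    calc q = (Finset.univ : Finset F).card := Finset.card_univ.symm
      _ ≤ _ := Finset.card_le_card h2
      _ ≤ _ := (Finset.card_union_le _ _).trans
        (add_le_add (Finset.card_union_le _ _) h1)
  have hcount : ∑ s ∈ bc, (brᶜ.filter fun t => Cf s t ≠ Rf s t).card +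
      ∑ t ∈ br, (bcᶜ.filter fun s => Cf s t ≠ Rf s t).card ≤ K := by
    refine le_trans ?_ hK
    have e1 : ∑ s ∈ bc, (brᶜ.filter fun t => Cf s t ≠ Rf s t).card =
        ((bc ×ˢ brᶜ).filter fun x : F × F => Cf x.1 x.2 ≠ Rf x.1 x.2).card := by
      simp only [Finset.card_filter, Finset.sum_product]
    have e2 : ∑ t ∈ br, (bcᶜ.filter fun s => Cf s t ≠ Rf s t).card =
        ((bcᶜ ×ˢ br).filter fun x : F × F => Cf x.1 x.2 ≠ Rf x.1 x.2).card := by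
      simp only [Finset.card_filter, Finset.sum_product_right]
    rw [e1, e2, ← Finset.card_union_of_disjoint]
    · exact Finset.card_le_card (by
        rw [← Finset.filter_union]
        exact Finset.filter_subset_filter _ (Finset.subset_univ _))
    · refine Finset.disjoint_filter_filter (Finset.disjoint_left.2 fun x hx hx' => ?_)
      simp only [Finset.mem_product, Finset.mem_compl] at hx hx'
      exact hx'.1 hx.1
  have s1 := Finset.sum_le_sum hcol
  have s2 := Finset.sum_le_sum hrow
  simp only [Finset.sum_add_distrib, Finset.sum_const, smul_eq_mul] at s1 s2
  -- The crude bound by `e < q / 2` bootstraps: it absorbs the double count `2 * bc.card * br.card`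
  -- into one of the terms `bc.card * q`, `br.card * q`, leaving the other bounded by `K + d * q`.
  have hc' : 2 * bc.card ≤ q := by omega
  have hr' : 2 * br.card ≤ q := by omega
  have hcr : (bc.card + br.card) * d ≤ q * d := Nat.mul_le_mul_right _ (by omega)
  have m1 : bc.card * (2 * br.card) ≤ bc.card * q := Nat.mul_le_mul_left _ hr'
  have m2 : br.card * (2 * bc.card) ≤ br.card * q := Nat.mul_le_mul_left _ hc'
  constructor <;> nlinarith

end Bivariate
end PolyLine

namespace PolyLine

/-! ### Counting -/

section Counting

variable {α β : Type*} [Fintype α] [Fintype β]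

open Classical in
/-- The number of elements with the property `p`. -/
noncomputable def cnt (p : α → Prop) : ℕ := (Finset.univ.filter p).card

theorem cnt_mono {p r : α → Prop} (h : ∀ a, p a → r a) : cnt p ≤ cnt r := by
  classical
  exact Finset.card_le_card (Finset.monotone_filter_right _ fun a _ => h a)

theorem cnt_le_card (p : α → Prop) : cnt p ≤ Fintype.card α := by
  classical
  exact Finset.card_le_univ _

theorem cnt_or_le (p r : α → Prop) : cnt (fun a => p a ∨ r a) ≤ cnt p + cnt r := by
  classical
  refine (Finset.card_le_card fun a ha => ?_).trans (Finset.card_union_le _ _)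
  simpa using ha

theorem cnt_add_cnt_not (p : α → Prop) : cnt p + cnt (fun a => ¬ p a) = Fintype.card α := by
  classical
  rw [← Finset.card_univ, ← Finset.card_filter_add_card_filter_not (s := Finset.univ) p]
  unfold cnt
  congr!

theorem cnt_comp_equiv (e : α ≃ β) (p : β → Prop) : cnt (fun a => p (e a)) = cnt p := by
  classical
  exact Finset.card_equiv e (by simp)

theorem cnt_eq_sum (p : α → Prop) [DecidablePred p] : (cnt p : ℝ) = ∑ a, if p a then 1 else 0 := by
  classical
  rw [Finset.sum_boole]
  unfold cnt
  congr!

theorem cnt_eq_sum_nat (p : α → Prop) [DecidablePred p] : cnt p = ∑ a, if p a then 1 else 0 := by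
  classical
  rw [Finset.sum_boole]
  unfold cnt
  simp only [Nat.cast_id]
  congr!

theorem cnt_prod (p : α × β → Prop) : cnt p = ∑ a, cnt (fun b => p (a, b)) := by
  classical
  simp only [cnt_eq_sum_nat, Fintype.sum_prod_type]

theorem cnt_prod_right (p : α × β → Prop) : cnt p = ∑ b, cnt (fun a => p (a, b)) := by
  classical
  simp only [cnt_eq_sum_nat, Fintype.sum_prod_type_right]

theorem sum_cnt_comm (p : α → β → Prop) :
    ∑ a, cnt (fun b => p a b) = ∑ b, cnt (fun a => p a b) := by
  rw [← cnt_prod (fun x : α × β => p x.1 x.2), cnt_prod_right]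

theorem cnt_fst (p : α → Prop) : cnt (fun x : α × β => p x.1) = Fintype.card β * cnt p := by
  classical
  rw [cnt_prod_right]
  simp

theorem exists_of_cnt_lt {p : α → Prop} (h : cnt p < Fintype.card α) : ∃ a, ¬ p a := by
  by_contra! hp
  have := cnt_add_cnt_not p
  have h0 : cnt (fun a => ¬ p a) = 0 := by simp [cnt, hp]
  omega

theorem cnt_pos_iff {p : α → Prop} : 0 < cnt p ↔ ∃ a, p a := by
  classical
  simp [cnt, Finset.card_pos, Finset.filter_nonempty_iff]

/-- Markov's inequality. -/
theorem cnt_le_of_sum_le (X : α → ℝ) (hX : ∀ a, 0 ≤ X a) (r : ℝ) :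
    cnt (fun a => r < X a) * r ≤ ∑ a, X a := by
  classical
  rw [cnt_eq_sum, Finset.sum_mul]
  refine Finset.sum_le_sum fun a _ => ?_
  split_ifs with h
  · rw [one_mul]
    exact h.le
  · rw [zero_mul]
    exact hX a

end Counting

/-- The best value does at least as well as the value at a random element. -/
theorem exists_popular {α β : Type*} [Fintype α] [Nonempty α] (φ : α → β) :
    ∃ b, Fintype.card α * cnt (fun a => φ a ≠ b) ≤ cnt (fun x : α × α => φ x.1 ≠ φ x.2) := by
  obtain ⟨a₀, h⟩ := Finite.exists_min fun a₀ => cnt (fun a => φ a ≠ φ a₀)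
  refine ⟨φ a₀, ?_⟩
  rw [cnt_prod_right, ← smul_eq_mul, ← Finset.card_univ, ← Finset.sum_const]
  exact Finset.sum_le_sum fun b _ => h b

section PairwiseIndependence

variable {F : Type*} [Field F] [Fintype F] {W : Type*} [AddCommGroup W] [Module F W] [Fintype W]

/-- Two different points of a random line are independent. -/
def twoPointEquiv {s s' : F} (h : s ≠ s') : W × W ≃ W × W where
  toFun x := (x.1 + s • x.2, x.1 + s' • x.2)
  invFun y := (y.1 - (s * (s - s')⁻¹) • (y.1 - y.2), (s - s')⁻¹ • (y.1 - y.2))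
  left_inv x := by
    have h0 : s - s' ≠ 0 := sub_ne_zero.2 h
    have h1 : (s - s')⁻¹ • (x.1 + s • x.2 - (x.1 + s' • x.2)) = x.2 := by
      rw [add_sub_add_left_eq_sub, ← sub_smul, smul_smul, inv_mul_cancel₀ h0, one_smul]
    refine Prod.ext ?_ h1
    simp only [mul_smul, h1]
    abel
  right_inv y := by
    have h0 : s - s' ≠ 0 := sub_ne_zero.2 h
    refine Prod.ext ?_ ?_
    · simp only [mul_smul]
      abel
    · have h2 : y.1 - y.2 = (s - s') • (s - s')⁻¹ • (y.1 - y.2) := by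
        rw [smul_smul, mul_inv_cancel₀ h0, one_smul]
      have h3 : y.1 - s • (s - s')⁻¹ • (y.1 - y.2) + s' • (s - s')⁻¹ • (y.1 - y.2) =
          y.1 - (s - s') • (s - s')⁻¹ • (y.1 - y.2) := by
        rw [sub_smul]
        abel
      simp only [mul_smul]
      rw [h3, ← h2]
      abel

/-- A point of a random line, together with the direction. -/
def shearEquiv (s : F) : W × W ≃ W × W where
  toFun x := (x.1 + s • x.2, x.2)
  invFun x := (x.1 - s • x.2, x.2)
  left_inv x := by simp
  right_inv x := by simp

/-- Expanding the square, the mixed terms vanish because two distinct points of a random line are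
independent and `φ` has mean zero. -/
theorem sum_sq_sum_line (φ : W → ℝ) (hφ : ∑ w, φ w = 0) :
    ∑ x : W × W, (∑ s : F, φ (x.1 + s • x.2)) ^ 2 =
      Fintype.card F * (Fintype.card W * ∑ w, φ w ^ 2) := by
  classical
  have h1 : ∀ s s' : F, ∑ x : W × W, φ (x.1 + s • x.2) * φ (x.1 + s' • x.2) =
      if s = s' then Fintype.card W * ∑ w, φ w ^ 2 else 0 := by
    intro s s'
    split_ifs with h
    · subst h
      refine ((shearEquiv s).sum_comp (fun y : W × W => φ y.1 * φ y.1)).trans ?_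
      rw [Fintype.sum_prod_type]
      simp [← sq, Finset.mul_sum]
    · refine ((twoPointEquiv h).sum_comp (fun y : W × W => φ y.1 * φ y.2)).trans ?_
      rw [Fintype.sum_prod_type]
      simp [← Finset.mul_sum, hφ]
  simp only [sq (∑ s : F, _), Finset.sum_mul_sum]
  rw [Finset.sum_comm]
  simp only [Finset.sum_comm (γ := W × W), h1]
  simp

/-- Chebyshev's inequality for the points of a random line. -/
theorem cnt_line_le [Nonempty W] (φ : W → ℝ) (h0 : ∀ w, 0 ≤ φ w) (h1 : ∀ w, φ w ≤ 1) {μ ε : ℝ}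
    (hμ : ∑ w, φ w ≤ μ * Fintype.card W) (hε : 0 < ε) :
    cnt (fun x : W × W => Fintype.card F * (μ + ε) < ∑ s : F, φ (x.1 + s • x.2)) *
      (ε ^ 2 * Fintype.card F) ≤ (Fintype.card W : ℝ) ^ 2 := by
  classical
  set q : ℝ := (Fintype.card F : ℝ) with hq
  set n : ℝ := (Fintype.card W : ℝ) with hn
  have hn0 : 0 < n := by rw [hn]; exact_mod_cast Fintype.card_pos
  have hq0 : 0 < q := by rw [hq]; exact_mod_cast Fintype.card_pos
  set M := (∑ w, φ w) / n with hM
  have hMμ : M ≤ μ := by rw [hM, div_le_iff₀ hn0]; exact hμ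
  have hM0 : 0 ≤ M := div_nonneg (Finset.sum_nonneg fun w _ => h0 w) hn0.le
  have hM1 : M ≤ 1 := by
    rw [hM, div_le_one hn0]
    calc ∑ w, φ w ≤ ∑ w : W, (1 : ℝ) := Finset.sum_le_sum fun w _ => h1 w
      _ = n := by simp [hn]
  have key := sum_sq_sum_line (F := F) (fun w => φ w - M) (by
    rw [Finset.sum_sub_distrib, Finset.sum_const, Finset.card_univ, nsmul_eq_mul, ← hn, hM]
    field_simp
    ring)
  have hsq : ∑ w, (φ w - M) ^ 2 ≤ n := by
    calc ∑ w, (φ w - M) ^ 2 ≤ ∑ w : W, (1 : ℝ) := Finset.sum_le_sum fun w _ => by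
          nlinarith [h0 w, h1 w]
      _ = n := by simp [hn]
  have hmk : (cnt (fun x : W × W => q * (μ + ε) < ∑ s : F, φ (x.1 + s • x.2)) : ℝ) *
      (q * ε) ^ 2 ≤ ∑ x : W × W, (∑ s : F, (φ (x.1 + s • x.2) - M)) ^ 2 := by
    rw [cnt_eq_sum, Finset.sum_mul]
    refine Finset.sum_le_sum fun x _ => ?_
    split_ifs with h
    · rw [one_mul]
      refine pow_le_pow_left₀ (by positivity) ?_ 2
      rw [Finset.sum_sub_distrib, Finset.sum_const, Finset.card_univ, nsmul_eq_mul, ← hq]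
      nlinarith
    · rw [zero_mul]
      positivity
  rw [key] at hmk
  have : (cnt (fun x : W × W => q * (μ + ε) < ∑ s : F, φ (x.1 + s • x.2)) : ℝ) *
      (ε ^ 2 * q) * q ≤ n ^ 2 * q := by
    calc _ = _ := by ring
      _ ≤ _ := hmk
      _ ≤ q * (n * n) := by gcongr
      _ = _ := by ring
  exact le_of_mul_le_mul_right this hq0

end PairwiseIndependence
end PolyLine

namespace PolyLine

open Polynomial

/-! ### Tables of line polynomials -/

section Tables

variable {F : Type u} [Field F]

theorem IsPolyFun.shift {d : ℕ} {φ : F → F} (h : IsPolyFun d φ) (r : F) :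
    IsPolyFun d fun t => φ (r + t) := by
  obtain ⟨p, hp, hpe⟩ := h
  refine ⟨p.comp (X + C r), ?_, fun t => by simp [← hpe, add_comm]⟩
  rw [natDegree_comp]
  simpa using hp

theorem isPolyFun_const (d : ℕ) (a : F) : IsPolyFun d fun _ : F => a :=
  ⟨C a, by simp, by simp⟩

variable [Fintype F]

theorem IsPolyFun.eq_of_cnt_lt {d : ℕ} {φ ψ : F → F} (hφ : IsPolyFun d φ) (hψ : IsPolyFun d ψ)
    (h : cnt (fun t => φ t ≠ ψ t) + d < Fintype.card F) : φ = ψ := by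
  classical
  refine hφ.eq_of_card_lt hψ ?_
  have := cnt_add_cnt_not fun t => φ t = ψ t
  have h2 : (Finset.univ.filter fun t => φ t = ψ t).card = cnt fun t => φ t = ψ t := by
    unfold cnt
    congr!
  rw [h2]
  simp only [ne_eq] at h
  omega

theorem cnt_ne_triangle {α β : Type*} [Fintype α] (f g h : α → β) :
    cnt (fun a => f a ≠ h a) ≤ cnt (fun a => f a ≠ g a) + cnt (fun a => g a ≠ h a) := by
  refine (cnt_mono fun a ha => ?_).trans (cnt_or_le _ _)
  by_contra! hc
  exact ha (hc.1.trans hc.2)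

variable {V : Type*} [AddCommGroup V] [Module F V]

/-- The value at a point of the line polynomial through that point in a given direction, for every
point and every direction. -/
def IsLineTable (d : ℕ) (G : V → V → F) : Prop :=
  ∀ y D, IsPolyFun d fun t : F => G (y + t • D) D

/-- The line polynomials are closest to `f` among all polynomials of degree at most `d`. -/
structure IsBestFit (d : ℕ) (f : V → F) (G : V → V → F) : Prop where
  isLineTable : IsLineTable d G
  cnt_le : ∀ y D φ, IsPolyFun d φ →
    cnt (fun t : F => G (y + t • D) D ≠ f (y + t • D)) ≤ cnt fun t : F => φ t ≠ f (y + t • D)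

/-- A line on which `f` is close to a polynomial has that polynomial as its best fit. -/
theorem IsBestFit.eq_of_cnt_lt {d : ℕ} {f : V → F} {G : V → V → F} (h : IsBestFit d f G)
    (y D : V) {φ : F → F} (hφ : IsPolyFun d φ)
    (hlt : 2 * cnt (fun t : F => φ t ≠ f (y + t • D)) + d < Fintype.card F) (t : F) :
    G (y + t • D) D = φ t := by
  have h1 := h.cnt_le y D φ hφ
  have h2 := cnt_ne_triangle (fun t : F => G (y + t • D) D) (fun t => f (y + t • D)) φ
  have h3 : cnt (fun t : F => f (y + t • D) ≠ φ t) = cnt (fun t : F => φ t ≠ f (y + t • D)) := by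
    simp only [ne_comm]
  exact congrFun ((h.isLineTable y D).eq_of_cnt_lt hφ (by omega)) t

/-- On a doubly ruled surface on which the line polynomials mostly agree with `f`, they come from
a bivariate polynomial. -/
theorem IsBestFit.exists_surface {d : ℕ} {f : V → F} {G : V → V → F} (h : IsBestFit d f G)
    (A : F → F → V) (c r : F → V) (hc : ∀ s t, A s t = A s 0 + t • c s)
    (hr : ∀ s t, A s t = A 0 t + s • r t) {e K : ℕ}
    (hK : cnt (fun x : F × F => G (A x.1 x.2) (c x.1) ≠ f (A x.1 x.2)) +
      cnt (fun x : F × F => G (A x.1 x.2) (r x.2) ≠ f (A x.1 x.2)) ≤ K)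
    (hKe : K < (e + 1) ^ 2) (hed : 2 * (e + d) < Fintype.card F) :
    ∃ (Q : F → F → F) (b : ℕ), b * Fintype.card F ≤ K + d * Fintype.card F ∧
      (∀ s, IsPolyFun d (Q s)) ∧ (∀ t, IsPolyFun d fun s => Q s t) ∧
      (∀ t, cnt (fun s => Q s t ≠ G (A s t) (c s)) ≤ b) ∧
      (∀ s, cnt (fun t => Q s t ≠ G (A s t) (r t)) ≤ b) ∧
      (∀ s, 2 * (b + cnt fun t => G (A s t) (r t) ≠ f (A s t)) + d < Fintype.card F →
        ∀ t, G (A s t) (c s) = Q s t) ∧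
      (∀ t, 2 * (b + cnt fun s => G (A s t) (c s) ≠ f (A s t)) + d < Fintype.card F →
        ∀ s, G (A s t) (r t) = Q s t) := by
  classical
  have hCpoly : ∀ s, IsPolyFun d fun t => G (A s t) (c s) := fun s => by
    simpa only [← hc] using h.isLineTable (A s 0) (c s)
  have hRpoly : ∀ t, IsPolyFun d fun s => G (A s t) (r t) := fun t => by
    simpa only [← hr] using h.isLineTable (A 0 t) (r t)
  have hdis : (Finset.univ.filter fun x : F × F =>
      G (A x.1 x.2) (c x.1) ≠ G (A x.1 x.2) (r x.2)).card ≤ K := by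
    refine le_trans ?_ hK
    have := cnt_ne_triangle (fun x : F × F => G (A x.1 x.2) (c x.1)) (fun x => f (A x.1 x.2))
      (fun x => G (A x.1 x.2) (r x.2))
    simp only [ne_comm (a := f _)] at this
    refine le_trans (le_of_eq ?_) this
    unfold cnt
    congr!
  obtain ⟨Q, hQc, hQr, hbc, hbr⟩ := exists_bivariate
    (Cf := fun s t => G (A s t) (c s)) (Rf := fun s t => G (A s t) (r t)) hCpoly hRpoly hdis hKe hed
  set b := max (Finset.univ.filter fun s => (fun t => G (A s t) (c s)) ≠ Q s).card
    (Finset.univ.filter fun t => (fun s => G (A s t) (r t)) ≠ fun s => Q s t).card with hb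
  have hC : ∀ t, cnt (fun s => Q s t ≠ G (A s t) (c s)) ≤ b := fun t => by
    refine le_trans (Finset.card_le_card fun s hs => ?_) (le_max_left _ _)
    simp only [Finset.mem_filter, Finset.mem_univ, true_and] at hs ⊢
    exact fun h => hs (congrFun h t).symm
  have hR : ∀ s, cnt (fun t => Q s t ≠ G (A s t) (r t)) ≤ b := fun s => by
    refine le_trans (Finset.card_le_card fun t ht => ?_) (le_max_right _ _)
    simp only [Finset.mem_filter, Finset.mem_univ, true_and] at ht ⊢
    exact fun h => ht (congrFun h s).symm
  refine ⟨Q, b, ?_, hQc, hQr, hC, hR, fun s hs t => ?_, fun t ht s => ?_⟩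
  · rcases max_choice (Finset.univ.filter fun s => (fun t => G (A s t) (c s)) ≠ Q s).card
      (Finset.univ.filter fun t => (fun s => G (A s t) (r t)) ≠ fun s => Q s t).card with h1 | h1
    · rw [hb, h1]
      exact hbc
    · rw [hb, h1]
      exact hbr
  -- Along column `s`, `Q` is close to the row polynomials and these are close to `f`; the best fit
  -- on the column must then be `Q s`, even if the column was one of the exceptional ones.
  · have h1 := cnt_ne_triangle (Q s) (fun t => G (A s t) (r t)) (fun t => f (A s t))
    have h2 := h.eq_of_cnt_lt (A s 0) (c s) (hQc s) (by
      simp only [← hc]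
      have := hR s
      omega) t
    rwa [← hc] at h2
  · have h1 := cnt_ne_triangle (fun s => Q s t) (fun s => G (A s t) (c s)) (fun s => f (A s t))
    have h2 := h.eq_of_cnt_lt (A 0 t) (r t) (hQr t) (by
      simp only [← hr]
      have := hC t
      omega) s
    rwa [← hr] at h2

variable [Fintype V]

theorem cnt_on_line {D : V} (hD : D ≠ 0) (y : V) (p : V → Prop) :
    cnt (fun z => (∃ t : F, z = y + t • D) ∧ p z) = cnt fun t : F => p (y + t • D) := by
  classical
  have hinj : Function.Injective fun t : F => y + t • D := fun a b h =>
    smul_left_injective F hD (add_left_cancel h)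
  unfold cnt
  rw [← Finset.card_image_of_injective _ hinj]
  congr 1
  ext z
  simp only [Finset.mem_filter, Finset.mem_univ, true_and, Finset.mem_image]
  constructor
  · rintro ⟨⟨t, rfl⟩, h⟩
    exact ⟨t, h, rfl⟩
  · rintro ⟨t, h, rfl⟩
    exact ⟨⟨t, rfl⟩, h⟩

theorem cnt_eq_cnt_and_add {α : Type*} [Fintype α] (p r : α → Prop) :
    cnt p = cnt (fun a => r a ∧ p a) + cnt (fun a => ¬ r a ∧ p a) := by
  classical
  simp only [cnt_eq_sum_nat, ← Finset.sum_add_distrib]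
  refine Finset.sum_congr rfl fun a _ => ?_
  by_cases h1 : p a <;> by_cases h2 : r a <;> simp [h1, h2]

/-- Minimising the total disagreement over all functions polynomial in direction `D` makes the
choice independent of the base point. The minimiser is optimal on each line, since parallel lines
are disjoint and the values on one can be replaced without touching the others. -/
theorem exists_bestFit_direction (d : ℕ) (f : V → F) (D : V) :
    ∃ g : V → F, (∀ y, IsPolyFun d fun t : F => g (y + t • D)) ∧
      ∀ y φ, IsPolyFun d φ →
        cnt (fun t : F => g (y + t • D) ≠ f (y + t • D)) ≤ cnt fun t : F => φ t ≠ f (y + t • D) := by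
  classical
  have : Nonempty {g : V → F // ∀ y, IsPolyFun d fun t : F => g (y + t • D)} :=
    ⟨⟨fun _ => 0, fun y => isPolyFun_const d 0⟩⟩
  obtain ⟨⟨g, hg⟩, hmin⟩ := Finite.exists_min
    fun g : {g : V → F // ∀ y, IsPolyFun d fun t : F => g (y + t • D)} =>
      cnt fun y => g.1 y ≠ f y
  refine ⟨g, hg, fun y φ hφ => ?_⟩
  by_cases hD : D = 0
  · subst hD
    have h1 := hmin ⟨f, fun y => by simpa using isPolyFun_const d (f y)⟩
    have h2 : cnt (fun y => f y ≠ f y) = 0 := by simp [cnt]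
    have h3 : ∀ z, g z = f z := by
      by_contra! h
      have := cnt_pos_iff.2 h
      simp only at h1
      omega
    simp [h3, cnt]
  · have hinj : Function.Injective fun t : F => y + t • D := fun a b h =>
      smul_left_injective F hD (add_left_cancel h)
    let g' : V → F := fun z => if h : ∃ t : F, z = y + t • D then φ h.choose else g z
    have hon : ∀ t : F, g' (y + t • D) = φ t := fun t => by
      have h : ∃ r : F, y + t • D = y + r • D := ⟨t, rfl⟩
      simp only [g', dif_pos h]
      exact congrArg φ (hinj h.choose_spec.symm)
    have hoff : ∀ z, (¬ ∃ t : F, z = y + t • D) → g' z = g z := fun z h => dif_neg h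
    have hg' : ∀ z, IsPolyFun d fun t : F => g' (z + t • D) := fun z => by
      by_cases hz : ∃ r : F, z = y + r • D
      · obtain ⟨r, rfl⟩ := hz
        simpa only [add_assoc, ← add_smul, hon] using hφ.shift r
      · convert hg z using 2 with t
        refine hoff _ fun ⟨r, hr⟩ => hz ⟨r - t, ?_⟩
        rw [sub_smul, ← add_sub_assoc, ← hr, add_sub_cancel_right]
    have h1 := hmin ⟨g', hg'⟩
    simp only at h1
    rw [cnt_eq_cnt_and_add (fun z => g z ≠ f z) (fun z => ∃ t : F, z = y + t • D),
      cnt_eq_cnt_and_add (fun z => g' z ≠ f z) (fun z => ∃ t : F, z = y + t • D),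
      cnt_on_line hD, cnt_on_line hD] at h1
    have h2 : cnt (fun z => (¬ ∃ t : F, z = y + t • D) ∧ g' z ≠ f z) =
        cnt (fun z => (¬ ∃ t : F, z = y + t • D) ∧ g z ≠ f z) := by
      congr 1
      funext z
      exact propext (and_congr_right fun h => by rw [hoff z h])
    simp only [hon, h2] at h1
    omega

theorem exists_bestFit (d : ℕ) (f : V → F) : ∃ G, IsBestFit d f G := by
  choose g hg hmin using exists_bestFit_direction (F := F) d f
  exact ⟨fun y D => g D y, fun y D => hg D y, fun y D => hmin D y⟩

theorem sum_cnt_line (p : V → V → Prop) :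
    ∑ x : V × V, cnt (fun t : F => p (x.1 + t • x.2) x.2) =
      Fintype.card F * cnt fun x : V × V => p x.1 x.2 := by
  rw [sum_cnt_comm (fun (x : V × V) (t : F) => p (x.1 + t • x.2) x.2), ← smul_eq_mul,
    ← Finset.card_univ, ← Finset.sum_const]
  exact Finset.sum_congr rfl fun t _ =>
    cnt_comp_equiv (shearEquiv t) (fun x : V × V => p x.1 x.2)

/-- `P` may give unrelated polynomials to different base points of the same line, as an arbitrary
word does; the best fit beats each of them separately. -/
theorem IsBestFit.card_mul_cnt_le {d : ℕ} {f : V → F} {G : V → V → F} (h : IsBestFit d f G)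
    (P : V → V → F → F) (hP : ∀ x D, IsPolyFun d (P x D)) :
    Fintype.card F * cnt (fun x : V × V => G x.1 x.2 ≠ f x.1) ≤
      ∑ x : V × V, cnt fun t : F => P x.1 x.2 t ≠ f (x.1 + t • x.2) := by
  rw [← sum_cnt_line (fun y D => G y D ≠ f y)]
  exact Finset.sum_le_sum fun x _ => h.cnt_le _ _ _ (hP _ _)

theorem IsBestFit.cnt_le_of_isLineTable {d : ℕ} {f : V → F} {G G' : V → V → F}
    (h : IsBestFit d f G) (h' : IsLineTable d G') :
    cnt (fun x : V × V => G x.1 x.2 ≠ f x.1) ≤ cnt (fun x : V × V => G' x.1 x.2 ≠ f x.1) := by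
  have := h.card_mul_cnt_le (fun x D t => G' (x + t • D) D) h'
  rw [sum_cnt_line (fun y D => G' y D ≠ f y)] at this
  exact Nat.le_of_mul_le_mul_left this Fintype.card_pos

end Tables
end PolyLine

namespace PolyLine

open Polynomial

/-! ### Random surfaces -/

section Surfaces

variable {F : Type u} [Field F] [Fintype F] {V : Type*} [AddCommGroup V] [Module F V] [Fintype V]

/-- Point and direction move together along a random line of `V × V`, so Chebyshev applies there. -/
theorem cnt_table_line_le {f : V → F} {G : V → V → F} {δ ε : ℝ} (hε : 0 < ε)
    (hδ : cnt (fun x : V × V => G x.1 x.2 ≠ f x.1) ≤ δ * (Fintype.card V : ℝ) ^ 2) :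
    cnt (fun x : (V × V) × (V × V) => Fintype.card F * (δ + ε) <
        cnt fun s : F => G (x.1.1 + s • x.2.1) (x.1.2 + s • x.2.2) ≠ f (x.1.1 + s • x.2.1)) *
      (ε ^ 2 * Fintype.card F) ≤ (Fintype.card V : ℝ) ^ 4 := by
  classical
  have := cnt_line_le (F := F) (W := V × V) (fun w => if G w.1 w.2 ≠ f w.1 then 1 else 0)
    (fun w => by positivity) (fun w => by split_ifs <;> norm_num) (μ := δ) (ε := ε)
    (by rw [← cnt_eq_sum]; simpa [sq] using hδ) hε
  simp only [← cnt_eq_sum, Fintype.card_prod] at this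
  refine le_trans (le_of_eq ?_) (this.trans (le_of_eq (by push_cast; ring)))
  rfl

/-- The lines of one ruling, as pairs (base, direction), form a random line of `V × V`. Chebyshev is
applied to the fraction of disagreement on each of them. -/
theorem cnt_table_surface_le {f : V → F} {G : V → V → F} {δ ε : ℝ} (hε : 0 < ε)
    (hδ : cnt (fun x : V × V => G x.1 x.2 ≠ f x.1) ≤ δ * (Fintype.card V : ℝ) ^ 2) :
    cnt (fun x : (V × V) × (V × V) => (Fintype.card F : ℝ) ^ 2 * (δ + ε) <
        cnt fun z : F × F =>
          G (x.1.1 + z.1 • x.2.1 + z.2 • (x.1.2 + z.1 • x.2.2)) (x.1.2 + z.1 • x.2.2) ≠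
            f (x.1.1 + z.1 • x.2.1 + z.2 • (x.1.2 + z.1 • x.2.2))) *
      (ε ^ 2 * Fintype.card F) ≤ (Fintype.card V : ℝ) ^ 4 := by
  classical
  have hq : (0 : ℝ) < Fintype.card F := by exact_mod_cast Fintype.card_pos
  let X : V × V → ℕ := fun w => cnt fun t : F => G (w.1 + t • w.2) w.2 ≠ f (w.1 + t • w.2)
  have hX : ∑ w, (X w : ℝ) =
      Fintype.card F * cnt fun x : V × V => G x.1 x.2 ≠ f x.1 := by
    exact_mod_cast sum_cnt_line fun y D => G y D ≠ f y
  have := cnt_line_le (F := F) (W := V × V) (fun w => (X w : ℝ) / Fintype.card F)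
    (fun w => by positivity)
    (fun w => (div_le_one hq).2 (by exact_mod_cast cnt_le_card _)) (μ := δ) (ε := ε)
    (by
      rw [← Finset.sum_div, hX, mul_div_cancel_left₀ _ hq.ne']
      simpa [sq] using hδ) hε
  simp only [Fintype.card_prod, ← Finset.sum_div, lt_div_iff₀ hq] at this
  refine le_trans (le_of_eq ?_) (this.trans (le_of_eq (by push_cast; ring)))
  congr 2
  congr 1
  funext x
  rw [cnt_prod]
  push_cast
  congr 1
  ring

/-- Two line polynomials through a random point agree at that point, except with probability
`O(1 / |F|)`. -/
theorem IsBestFit.sum_cnt_ne_le {d : ℕ} {f : V → F} {G : V → V → F} (h : IsBestFit d f G)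
    {ε : ℝ} (hε : 0 < ε) (hε' : ε < 1 / 8)
    (hδ : cnt (fun x : V × V => G x.1 x.2 ≠ f x.1) ≤ (1 / 8 - ε) * (Fintype.card V : ℝ) ^ 2)
    (hd : d < ε * Fintype.card F) :
    (∑ y : V, cnt fun z : V × V => G y z.1 ≠ G y z.2 : ℕ) * (ε ^ 2 * Fintype.card F) ≤
      16 * (Fintype.card V : ℝ) ^ 3 := by
  classical
  set q : ℝ := (Fintype.card F : ℝ) with hq
  set n : ℝ := (Fintype.card V : ℝ) with hn
  have hq0 : 0 < q := by rw [hq]; exact_mod_cast Fintype.card_pos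
  have hn0 : 0 < n := by rw [hn]; exact_mod_cast Fintype.card_pos
  -- `σ` exchanges the two rulings. `B1` says that one ruling is bad on the surface as a whole, `B2`
  -- that it is bad along the single transverse line through `u`.
  let σ : (V × V) × (V × V) ≃ (V × V) × (V × V) := Equiv.prodProdProdComm V V V V
  let B1 : (V × V) × (V × V) → Prop := fun x => q ^ 2 * ((1 / 8 - ε) + ε / 2) <
    cnt fun z : F × F =>
      G (x.1.1 + z.1 • x.2.1 + z.2 • (x.1.2 + z.1 • x.2.2)) (x.1.2 + z.1 • x.2.2) ≠
        f (x.1.1 + z.1 • x.2.1 + z.2 • (x.1.2 + z.1 • x.2.2))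
  let B2 : (V × V) × (V × V) → Prop := fun x => q * ((1 / 8 - ε) + ε / 2) <
    cnt fun s : F => G (x.1.1 + s • x.2.1) (x.1.2 + s • x.2.2) ≠ f (x.1.1 + s • x.2.1)
  have hB1 : cnt B1 * ((ε / 2) ^ 2 * q) ≤ n ^ 4 :=
    cnt_table_surface_le (half_pos hε) hδ
  have hB2 : cnt B2 * ((ε / 2) ^ 2 * q) ≤ n ^ 4 :=
    cnt_table_line_le (half_pos hε) hδ
  have hB1' : cnt (fun x => B1 (σ x)) = cnt B1 := cnt_comp_equiv σ B1
  have hB2' : cnt (fun x => B2 (σ x)) = cnt B2 := cnt_comp_equiv σ B2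
  have hgood : ∀ x : (V × V) × (V × V), G x.1.1 x.1.2 ≠ G x.1.1 x.2.1 →
      (B1 x ∨ B1 (σ x)) ∨ (B2 x ∨ B2 (σ x)) := by
    rintro ⟨⟨u, u'⟩, ⟨v, v'⟩⟩ hne
    by_contra! hcon
    obtain ⟨⟨g1, g2⟩, g3, g4⟩ := hcon
    simp only [B1, B2, σ, Equiv.prodProdProdComm_apply, not_lt] at g1 g2 g3 g4
    apply hne
    have hA : ∀ s t : F, u + t • u' + s • (v + t • v') = u + s • v + t • (u' + s • v') := by
      intro s t
      simp only [smul_add, smul_smul, mul_comm t s]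
      abel
    have g2' : (cnt fun z : F × F => G (u + z.1 • v + z.2 • (u' + z.1 • v')) (v + z.2 • v') ≠
        f (u + z.1 • v + z.2 • (u' + z.1 • v')) : ℝ) ≤ q ^ 2 * ((1 / 8 - ε) + ε / 2) := by
      refine le_trans (le_of_eq ?_) g2
      rw [← cnt_comp_equiv (Equiv.prodComm F F)]
      simp only [Equiv.prodComm_apply, Prod.fst_swap, Prod.snd_swap, hA]
    -- The total disagreement is at most `(1/4 - ε) q²`, below `((1/2 - ε) q)²`, while `e + d < q /
    -- 2` because `d < ε q`.
    obtain ⟨Q, b, hb, -, -, -, -, hQc, hQr⟩ := h.exists_surface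
      (fun s t => u + s • v + t • (u' + s • v')) (fun s => u' + s • v') (fun t => v + t • v')
      (fun s t => by simp) (fun s t => by rw [← hA]; simp only [zero_smul, add_zero]) (e := ⌊(1 / 2 - ε) * q⌋₊)
      (K := _) le_rfl (by
        have h1 := Nat.lt_floor_add_one ((1 / 2 - ε) * q)
        have h2 : ((1 / 2 - ε) * q) ^ 2 < ((⌊(1 / 2 - ε) * q⌋₊ : ℝ) + 1) ^ 2 :=
          pow_lt_pow_left₀ h1 (by nlinarith) two_ne_zero
        rw [← Nat.cast_lt (α := ℝ)]
        push_cast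
        refine lt_of_le_of_lt ?_ h2
        refine (add_le_add g1 g2').trans ?_
        nlinarith [mul_pos hq0 hq0, mul_pos hε hε, mul_nonneg (sq_nonneg q) (sq_nonneg ε)])
      (by
        have h1 := Nat.floor_le (a := (1 / 2 - ε) * q) (by nlinarith)
        rw [← Nat.cast_lt (α := ℝ)]
        push_cast
        rw [← hq]
        linarith)
    have hb' : (b : ℝ) ≤ q * (1 / 4 - ε) + d := by
      rw [← Nat.cast_le (α := ℝ)] at hb
      push_cast at hb
      rw [← hq] at hb
      have : (b : ℝ) * q ≤ (q * (1 / 4 - ε) + d) * q := by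
        refine hb.trans ((add_le_add (add_le_add g1 g2') le_rfl).trans (le_of_eq ?_))
        ring
      exact le_of_mul_le_mul_right this hq0
    -- Both lines through `u` carry the restriction of `Q`: `2 (b + q (1/8 - ε/2)) + d ≤ 3/4 q - 3 ε
    -- q + 3 d < q`.
    have e1 := hQc 0 (by
      rw [← Nat.cast_lt (α := ℝ)]
      push_cast
      rw [← hq]
      simp only [zero_smul, add_zero]
      linarith) 0
    have e2 := hQr 0 (by
      rw [← Nat.cast_lt (α := ℝ)]
      push_cast
      rw [← hq]
      simp only [zero_smul, add_zero]
      linarith) 0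
    simp only [zero_smul, add_zero] at e1 e2
    rw [e1, e2]
  have htot : (cnt fun x : (V × V) × (V × V) => G x.1.1 x.1.2 ≠ G x.1.1 x.2.1 : ℝ) *
      (ε ^ 2 * q) ≤ 16 * n ^ 4 := by
    have h1 : cnt (fun x : (V × V) × (V × V) => G x.1.1 x.1.2 ≠ G x.1.1 x.2.1) ≤
        (cnt B1 + cnt B1) + (cnt B2 + cnt B2) := by
      refine (cnt_mono hgood).trans ((cnt_or_le _ _).trans (add_le_add ?_ ?_))
      · exact (cnt_or_le _ _).trans (by rw [hB1'])
      · exact (cnt_or_le _ _).trans (by rw [hB2'])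
    have h2 : (cnt fun x : (V × V) × (V × V) => G x.1.1 x.1.2 ≠ G x.1.1 x.2.1 : ℝ) ≤
        (cnt B1 + cnt B1) + (cnt B2 + cnt B2) := by exact_mod_cast h1
    have h3 : 0 < ε ^ 2 * q := by positivity
    nlinarith
  -- The event does not involve the fourth vector, which contributes a factor `n` to be cancelled.
  let τ : (V × V) × (V × V) ≃ (V × (V × V)) × V :=
    ⟨fun x => ((x.1.1, (x.1.2, x.2.1)), x.2.2), fun x => ((x.1.1, x.1.2.1), (x.1.2.2, x.2)),
      fun _ => rfl, fun _ => rfl⟩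
  have hτ : cnt (fun x : (V × V) × (V × V) => G x.1.1 x.1.2 ≠ G x.1.1 x.2.1) =
      Fintype.card V * ∑ y : V, cnt fun z : V × V => G y z.1 ≠ G y z.2 := by
    rw [← cnt_prod (fun x : V × (V × V) => G x.1 x.2.1 ≠ G x.1 x.2.2), ← cnt_fst,
      ← cnt_comp_equiv τ]
    rfl
  rw [hτ] at htot
  push_cast at htot ⊢
  rw [← hn] at htot
  refine le_of_mul_le_mul_left ?_ hn0
  linarith

end Surfaces
end PolyLine

namespace PolyLine

open Polynomial

/-! ### Self-correction -/

section SelfCorrection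

variable {F : Type u} [Field F] [Fintype F] {V : Type*} [AddCommGroup V] [Module F V] [Fintype V]

/-- A point of a random surface through `x`, and the direction of one ruling at that point. -/
def surfaceEquiv (x : V) {s : F} (hs : s ≠ 0) (t : F) : V × (V × V) ≃ (V × V) × V where
  toFun w := ((x + s • w.1 + t • (w.2.1 + s • w.2.2), w.2.1 + s • w.2.2), w.2.2)
  invFun z := (s⁻¹ • (z.1.1 - x - t • z.1.2), (z.1.2 - s • z.2, z.2))
  left_inv w := by
    refine Prod.ext ?_ (Prod.ext (by simp) rfl)
    have : x + s • w.1 + t • (w.2.1 + s • w.2.2) - x - t • (w.2.1 + s • w.2.2) = s • w.1 := by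
      abel
    simp only [this, smul_smul, inv_mul_cancel₀ hs, one_smul]
  right_inv z := by
    refine Prod.ext (Prod.ext ?_ (by simp)) rfl
    simp only [smul_smul, mul_inv_cancel₀ hs, one_smul, sub_add_cancel]
    abel

/-- A point of a random surface containing a given line, and the direction of the ruling of that
line at that point. -/
def surfaceLineEquiv (x D : V) (s : F) {t : F} (ht : t ≠ 0) : V × V ≃ V × V where
  toFun w := (x + s • D + t • (w.1 + s • w.2), D + t • w.2)
  invFun z := (t⁻¹ • (z.1 - (x + s • D)) - s • t⁻¹ • (z.2 - D), t⁻¹ • (z.2 - D))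
  left_inv w := by
    simp only [add_sub_cancel_left, smul_smul, inv_mul_cancel₀ ht, one_smul, add_sub_cancel_right,
      Prod.mk.eta]
  right_inv z := by
    simp only [sub_add_cancel, smul_smul, mul_inv_cancel₀ ht, one_smul, add_sub_cancel]

theorem sum_le_of_forall_ne_zero (X : F → ℝ) {a n : ℝ} (hn : 0 ≤ n) (h : ∀ s, X s ≤ n)
    (h' : ∀ s, s ≠ 0 → X s ≤ a * n) (ha : 0 ≤ a) :
    ∑ s, X s ≤ Fintype.card F * ((a + 1 / Fintype.card F) * n) := by
  classical
  have hq : (0 : ℝ) < Fintype.card F := by exact_mod_cast Fintype.card_pos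
  calc ∑ s, X s ≤ ∑ s : F, (a * n + if s = 0 then n else 0) := by
        refine Finset.sum_le_sum fun s _ => ?_
        split_ifs with h0
        · have := h s
          nlinarith
        · simpa using h' s h0
    _ = Fintype.card F * ((a + 1 / Fintype.card F) * n) := by
        rw [Finset.sum_add_distrib, Finset.sum_const, Finset.card_univ, nsmul_eq_mul]
        simp only [Finset.sum_ite_eq', Finset.mem_univ, if_true]
        field_simp

theorem cnt_lt_mul_le {α : Type*} [Fintype α] (X : α → ℕ) {q r κ n : ℝ} (hq : 0 < q)
    (hX : ((∑ a, X a : ℕ) : ℝ) ≤ q * (κ * n)) :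
    cnt (fun a => q * r < X a) * r ≤ κ * n := by
  have := cnt_le_of_sum_le (fun a => (X a : ℝ)) (fun a => Nat.cast_nonneg _) (q * r)
  push_cast at hX
  refine le_of_mul_le_mul_left ?_ hq
  linarith

/-- With the corner `x` fixed, a point of the surface and its ruling direction are still uniform
unless `s = 0`; that one parameter costs the extra `1 / |F|`. Only averages are controlled, so
Markov's inequality takes over from Chebyshev's. -/
theorem sum_cnt_surface_le {f : V → F} {G : V → V → F} {δ : ℝ} (hδ0 : 0 ≤ δ)
    (hδ : cnt (fun x : V × V => G x.1 x.2 ≠ f x.1) ≤ δ * (Fintype.card V : ℝ) ^ 2) (x : V) (t : F) :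
    ((∑ w : V × (V × V), cnt fun s : F =>
      G (x + s • w.1 + t • (w.2.1 + s • w.2.2)) (w.2.1 + s • w.2.2) ≠
        f (x + s • w.1 + t • (w.2.1 + s • w.2.2)) : ℕ) : ℝ) ≤
      Fintype.card F * ((δ + 1 / Fintype.card F) * (Fintype.card V : ℝ) ^ 3) := by
  rw [sum_cnt_comm (fun (w : V × (V × V)) (s : F) =>
      G (x + s • w.1 + t • (w.2.1 + s • w.2.2)) (w.2.1 + s • w.2.2) ≠
        f (x + s • w.1 + t • (w.2.1 + s • w.2.2)))]
  push_cast
  refine sum_le_of_forall_ne_zero _ (by positivity) (fun s => ?_) (fun s hs => ?_) hδ0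
  · refine (Nat.cast_le.2 (cnt_le_card _)).trans (le_of_eq ?_)
    simp only [Fintype.card_prod]
    push_cast
    ring
  · have h1 := cnt_comp_equiv (surfaceEquiv x hs t)
      (fun z : (V × V) × V => G z.1.1 z.1.2 ≠ f z.1.1)
    rw [cnt_fst (fun z : V × V => G z.1 z.2 ≠ f z.1)] at h1
    refine le_trans (le_of_eq (congrArg Nat.cast h1)) ?_
    push_cast
    have : (0 : ℝ) ≤ Fintype.card V := Nat.cast_nonneg _
    nlinarith

/-- Through every point, most pairs of line polynomials agree at that point, and most line
polynomials are close to `f`. -/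
theorem IsBestFit.cnt_inconsistent_le {d : ℕ} {f : V → F} {G : V → V → F} {δ : ℝ}
    (h : IsBestFit d f G) (hδ0 : 0 ≤ δ)
    (hδ : cnt (fun x : V × V => G x.1 x.2 ≠ f x.1) ≤ δ * (Fintype.card V : ℝ) ^ 2)
    (hd : 512 * d ≤ Fintype.card F) (x : V) :
    (cnt fun w : V × (V × V) => ¬ (G x w.1 = G x w.2.1 ∧
      128 * cnt (fun s : F => G (x + s • w.1) w.1 ≠ f (x + s • w.1)) ≤ Fintype.card F) : ℝ) ≤
      2048 * ((δ + 1 / Fintype.card F) * (Fintype.card V : ℝ) ^ 3) := by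
  set q : ℝ := (Fintype.card F : ℝ) with hq
  set n : ℝ := (Fintype.card V : ℝ) with hn
  have hq0 : 0 < q := by rw [hq]; exact_mod_cast Fintype.card_pos
  let σ : V × (V × V) ≃ V × (V × V) :=
    ⟨fun w => (w.2.1, (w.1, w.2.2)), fun w => (w.2.1, (w.1, w.2.2)), fun _ => rfl, fun _ => rfl⟩
  let X : V × (V × V) → ℕ := fun w => cnt fun z : F × F =>
    G (x + z.1 • w.1 + z.2 • (w.2.1 + z.1 • w.2.2)) (w.2.1 + z.1 • w.2.2) ≠
      f (x + z.1 • w.1 + z.2 • (w.2.1 + z.1 • w.2.2))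
  let Y : V × (V × V) → ℕ := fun w => cnt fun s : F =>
    G (x + s • w.1) (w.2.1 + s • w.2.2) ≠ f (x + s • w.1)
  have hX : ((∑ w, X w : ℕ) : ℝ) ≤ q ^ 2 * ((δ + 1 / q) * n ^ 3) := by
    simp only [X, cnt_prod_right]
    rw [Finset.sum_comm]
    push_cast
    calc _ ≤ ∑ t : F, q * ((δ + 1 / q) * n ^ 3) := Finset.sum_le_sum fun t _ => by
          have := sum_cnt_surface_le hδ0 hδ x t
          push_cast at this
          exact this
      _ = _ := by
          rw [Finset.sum_const, Finset.card_univ, nsmul_eq_mul, ← hq]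
          ring
  have hY : ((∑ w, Y w : ℕ) : ℝ) ≤ q * ((δ + 1 / q) * n ^ 3) := by
    simpa only [zero_smul, add_zero] using sum_cnt_surface_le hδ0 hδ x (0 : F)
  have hX' := cnt_lt_mul_le (r := 1 / 512) X (by positivity) hX
  have hY' := cnt_lt_mul_le (r := 1 / 512) Y hq0 hY
  have hXσ : cnt (fun w => q ^ 2 * (1 / 512) < X (σ w)) = cnt (fun w => q ^ 2 * (1 / 512) < X w) :=
    cnt_comp_equiv σ (fun w => q ^ 2 * (1 / 512) < X w)
  have hYσ : cnt (fun w => q * (1 / 512) < Y (σ w)) = cnt (fun w => q * (1 / 512) < Y w) :=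
    cnt_comp_equiv σ (fun w => q * (1 / 512) < Y w)
  have hbad : cnt (fun w : V × (V × V) => ¬ (G x w.1 = G x w.2.1 ∧
      128 * cnt (fun s : F => G (x + s • w.1) w.1 ≠ f (x + s • w.1)) ≤ Fintype.card F)) ≤
      (cnt (fun w => q ^ 2 * (1 / 512) < X w) + cnt (fun w => q ^ 2 * (1 / 512) < X w)) +
      (cnt (fun w => q * (1 / 512) < Y w) + cnt (fun w => q * (1 / 512) < Y w)) := by
    nth_rw 2 [← hXσ]
    nth_rw 2 [← hYσ]
    refine le_trans (cnt_mono ?_) ((cnt_or_le _ _).trans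
      (add_le_add (cnt_or_le _ _) (cnt_or_le _ _)))
    rintro ⟨h1, h2, v'⟩ hne
    by_contra! hcon
    obtain ⟨⟨g1, g2⟩, g3, g4⟩ := hcon
    simp only [X, Y, σ, Equiv.coe_fn_mk] at g1 g2 g3 g4
    apply hne
    have hA : ∀ s t : F, x + t • h2 + s • (h1 + t • v') = x + s • h1 + t • (h2 + s • v') := by
      intro s t
      simp only [smul_add, smul_smul, mul_comm t s]
      abel
    have g2' : (cnt fun z : F × F => G (x + z.1 • h1 + z.2 • (h2 + z.1 • v')) (h1 + z.2 • v') ≠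
        f (x + z.1 • h1 + z.2 • (h2 + z.1 • v')) : ℝ) ≤ q ^ 2 * (1 / 512) := by
      refine le_trans (le_of_eq ?_) g2
      rw [← cnt_comp_equiv (Equiv.prodComm F F)]
      simp only [Equiv.prodComm_apply, Prod.fst_swap, Prod.snd_swap, hA]
    have hd' : 512 * (d : ℝ) ≤ q := by rw [hq]; exact_mod_cast hd
    -- Four Markov bounds at level `1/512` give the factor `2048`. The disagreement is now at most
    -- `q² / 256`, so `e` about `q / 4` is ample.
    obtain ⟨Q, b, hb, -, -, hQ1, -, hQc, hQr⟩ := h.exists_surface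
      (fun s t => x + s • h1 + t • (h2 + s • v')) (fun s => h2 + s • v') (fun t => h1 + t • v')
      (fun s t => by simp) (fun s t => by rw [← hA]; simp only [zero_smul, add_zero])
      (e := Fintype.card F / 4) (K := _) le_rfl (by
        have e1 : q < 4 * (((Fintype.card F / 4 : ℕ) : ℝ) + 1) := by
          rw [hq]
          exact_mod_cast (by omega : Fintype.card F < 4 * (Fintype.card F / 4 + 1))
        rw [← Nat.cast_lt (α := ℝ)]
        push_cast
        nlinarith)
      (by have := Fintype.card_pos (α := F); omega)
    have hb' : (b : ℝ) ≤ q / 256 + d := by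
      rw [← Nat.cast_le (α := ℝ)] at hb
      push_cast at hb
      rw [← hq] at hb
      have : (b : ℝ) * q ≤ (q / 256 + d) * q := by
        refine hb.trans ((add_le_add (add_le_add g1 g2') le_rfl).trans (le_of_eq ?_))
        ring
      exact le_of_mul_le_mul_right this hq0
    have e1 := hQc 0 (by
      rw [← Nat.cast_lt (α := ℝ)]
      push_cast
      rw [← hq]
      simp only [zero_smul, add_zero]
      linarith)
    have e2 := hQr 0 (by
      rw [← Nat.cast_lt (α := ℝ)]
      push_cast
      rw [← hq]
      simp only [zero_smul, add_zero]
      linarith)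
    have e3 := hQ1 0
    simp only [zero_smul, add_zero] at e1 e2 e3
    constructor
    · have e4 := e1 0
      have e5 := e2 0
      simp only [zero_smul, add_zero] at e4 e5
      rw [e4, e5]
    · simp only [e2]
      -- The distance to `f` is at most `q/256 + d + q/512`, which is at most `q/128` because `512 d
      -- ≤ q`.
      have e4 := cnt_ne_triangle (fun s => Q s 0) (fun s => G (x + s • h1) (h2 + s • v'))
        (fun s => f (x + s • h1))
      have e5 : ((cnt fun s => Q s 0 ≠ f (x + s • h1) : ℕ) : ℝ) ≤ q / 256 + d + q * (1 / 512) := by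
        refine (Nat.cast_le.2 (e4.trans (add_le_add_left e3 _))).trans ?_
        push_cast
        linarith
      rw [← Nat.cast_le (α := ℝ)]
      push_cast
      rw [← hq]
      linarith
  rw [← Nat.cast_le (α := ℝ)] at hbad
  push_cast at hbad
  linarith

/-- The corrected function is a polynomial on every line. -/
theorem IsBestFit.isPolyFun_corrected {d : ℕ} {f g : V → F} {G : V → V → F} {δ κ η : ℝ}
    (h : IsBestFit d f G) (hδ0 : 0 ≤ δ)
    (hδ : cnt (fun x : V × V => G x.1 x.2 ≠ f x.1) ≤ δ * (Fintype.card V : ℝ) ^ 2)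
    (hκ : κ = δ + 1 / Fintype.card F)
    (hline : ∀ x, ((∑ D : V, cnt fun t : F => G (x + t • D) D ≠ f (x + t • D) : ℕ) : ℝ) ≤
      Fintype.card F * (1 / 64 * Fintype.card V))
    (hg : ∀ x, (cnt fun D => G x D ≠ g x : ℝ) ≤ η * Fintype.card V)
    (hsmall : 48 * κ + 17 * η < 1 / 2)
    (hd : 512 * d ≤ Fintype.card F) (x D : V) :
    IsPolyFun d fun s : F => g (x + s • D) := by
  set q : ℝ := (Fintype.card F : ℝ) with hq
  set n : ℝ := (Fintype.card V : ℝ) with hn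
  have hq0 : 0 < q := by rw [hq]; exact_mod_cast Fintype.card_pos
  have hn0 : 0 < n := by rw [hn]; exact_mod_cast Fintype.card_pos_iff.2 ⟨0⟩
  have hd' : 512 * (d : ℝ) ≤ q := by rw [hq]; exact_mod_cast hd
  have hκ0 : 0 ≤ κ := by rw [hκ]; positivity
  -- The surface contains the given line as its row `t = 0` and is otherwise random. `X` and `Y`
  -- measure columns and rows against `f`, `Z` the columns against `g` on the given line, and `U s`
  -- the rows against `f` along column `s`.
  let X : V × V → ℕ := fun w => cnt fun z : F × F =>
    G (x + z.1 • D + z.2 • (w.1 + z.1 • w.2)) (w.1 + z.1 • w.2) ≠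
      f (x + z.1 • D + z.2 • (w.1 + z.1 • w.2))
  let Y : V × V → ℕ := fun w => cnt fun z : F × F =>
    G (x + z.1 • D + z.2 • (w.1 + z.1 • w.2)) (D + z.2 • w.2) ≠
      f (x + z.1 • D + z.2 • (w.1 + z.1 • w.2))
  let Z : V × V → ℕ := fun w => cnt fun s : F =>
    G (x + s • D) (w.1 + s • w.2) ≠ g (x + s • D)
  let U : F → V × V → ℕ := fun s w => cnt fun t : F =>
    G (x + s • D + t • (w.1 + s • w.2)) (D + t • w.2) ≠ f (x + s • D + t • (w.1 + s • w.2))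
  have hX : ((∑ w, X w : ℕ) : ℝ) ≤ q ^ 2 * (1 / 64 * n ^ 2) := by
    simp only [X, cnt_prod]
    rw [Finset.sum_comm]
    push_cast
    calc _ ≤ ∑ s : F, q * (1 / 64 * n ^ 2) := Finset.sum_le_sum fun s _ => by
          have e1 : ∑ w : V × V, (cnt fun t : F =>
              G (x + s • D + t • (w.1 + s • w.2)) (w.1 + s • w.2) ≠
                f (x + s • D + t • (w.1 + s • w.2))) = Fintype.card V *
              ∑ c : V, cnt fun t : F => G (x + s • D + t • c) c ≠ f (x + s • D + t • c) := by
            refine ((shearEquiv s).sum_comp (fun z : V × V => cnt fun t : F =>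
              G (x + s • D + t • z.1) z.1 ≠ f (x + s • D + t • z.1))).trans ?_
            rw [Fintype.sum_prod_type_right]
            simp
          have e2 := hline (x + s • D)
          rw [← Nat.cast_sum, e1, Nat.cast_mul, ← hn]
          nlinarith
      _ = _ := by
          rw [Finset.sum_const, Finset.card_univ, nsmul_eq_mul, ← hq]
          ring
  have hU : ∀ s, ((∑ w, U s w : ℕ) : ℝ) ≤ q * (κ * n ^ 2) := by
    intro s
    simp only [U]
    rw [sum_cnt_comm (fun (w : V × V) (t : F) =>
      G (x + s • D + t • (w.1 + s • w.2)) (D + t • w.2) ≠ f (x + s • D + t • (w.1 + s • w.2))), hκ]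
    push_cast
    refine sum_le_of_forall_ne_zero _ (by positivity) (fun t => ?_) (fun t ht => ?_) hδ0
    · refine (Nat.cast_le.2 (cnt_le_card _)).trans (le_of_eq ?_)
      simp only [Fintype.card_prod]
      push_cast
      ring
    · have h1 := cnt_comp_equiv (surfaceLineEquiv x D s ht)
        (fun z : V × V => G z.1 z.2 ≠ f z.1)
      exact (le_of_eq (congrArg Nat.cast h1)).trans hδ
  have hY : ((∑ w, Y w : ℕ) : ℝ) ≤ q ^ 2 * (κ * n ^ 2) := by
    simp only [Y, cnt_prod]
    rw [Finset.sum_comm]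
    push_cast
    calc _ ≤ ∑ s : F, q * (κ * n ^ 2) := Finset.sum_le_sum fun s _ => by
          have := hU s
          push_cast at this
          exact this
      _ = _ := by
          rw [Finset.sum_const, Finset.card_univ, nsmul_eq_mul, ← hq]
          ring
  have hP : ∀ s : F, (cnt fun w : V × V => G (x + s • D) (w.1 + s • w.2) ≠ g (x + s • D) : ℝ) ≤
      η * n ^ 2 := by
    intro s
    have h1 := cnt_comp_equiv (shearEquiv s)
        (fun z : V × V => G (x + s • D) z.1 ≠ g (x + s • D))
    rw [cnt_fst (fun c : V => G (x + s • D) c ≠ g (x + s • D))] at h1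
    refine (le_of_eq (congrArg Nat.cast h1)).trans ?_
    have h2 := hg (x + s • D)
    rw [Nat.cast_mul, ← hn]
    nlinarith
  have hZ : ((∑ w, Z w : ℕ) : ℝ) ≤ q * (η * n ^ 2) := by
    simp only [Z]
    rw [sum_cnt_comm (fun (w : V × V) (s : F) => G (x + s • D) (w.1 + s • w.2) ≠ g (x + s • D))]
    push_cast
    calc _ ≤ ∑ s : F, η * n ^ 2 := Finset.sum_le_sum fun s _ => hP s
      _ = _ := by rw [Finset.sum_const, Finset.card_univ, nsmul_eq_mul, ← hq]
  have hX' := cnt_lt_mul_le (r := 1 / 32) X (by positivity) hX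
  have hY' := cnt_lt_mul_le (r := 1 / 32) Y (by positivity) hY
  have hZ' := cnt_lt_mul_le (r := 1 / 16) Z hq0 hZ
  -- No single surface need be good at every point of the line, so a surface is chosen for each `s₀`
  -- and the resulting polynomials are compared afterwards.
  have key : ∀ s₀ : F, ∃ φ : F → F, IsPolyFun d φ ∧ φ s₀ = g (x + s₀ • D) ∧
      (cnt fun s => φ s ≠ g (x + s • D) : ℝ) ≤ q / 8 + d := by
    intro s₀
    have hU' := cnt_lt_mul_le (r := 1 / 16) (U s₀) hq0 (hU s₀)
    have hP' := hP s₀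
    -- The failure probabilities are `1/2` for `X`, `32 κ` for `Y`, `16 η` for `Z`, `16 κ` for `U
    -- s₀` and `η` at `s₀` itself. Their sum is below `1` by `hsmall`.
    obtain ⟨⟨h2, v'⟩, hw⟩ := exists_of_cnt_lt (p := fun w : V × V =>
      (q ^ 2 * (1 / 32) < X w ∨ q ^ 2 * (1 / 32) < Y w) ∨
      (q * (1 / 16) < Z w ∨ q * (1 / 16) < U s₀ w) ∨
      G (x + s₀ • D) (w.1 + s₀ • w.2) ≠ g (x + s₀ • D)) (by
      rw [← Nat.cast_lt (α := ℝ)]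
      refine lt_of_le_of_lt (Nat.cast_le.2 ((cnt_or_le _ _).trans (add_le_add (cnt_or_le _ _)
        ((cnt_or_le _ _).trans (add_le_add (cnt_or_le _ _) le_rfl))))) ?_
      rw [Fintype.card_prod]
      push_cast
      rw [← hn]
      have : 0 < n ^ 2 := by positivity
      nlinarith)
    push Not at hw
    obtain ⟨⟨g1, g2⟩, ⟨g3, g4⟩, g5⟩ := hw
    simp only [X, Y, Z, U] at g1 g2 g3 g4 g5
    have hA : ∀ s t : F, x + t • h2 + s • (D + t • v') = x + s • D + t • (h2 + s • v') := by
      intro s t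
      simp only [smul_add, smul_smul, mul_comm t s]
      abel
    obtain ⟨Q, b, hb, -, hQr, hQ1, -, hQc, -⟩ := h.exists_surface
      (fun s t => x + s • D + t • (h2 + s • v')) (fun s => h2 + s • v') (fun t => D + t • v')
      (fun s t => by simp) (fun s t => by rw [← hA]; simp only [zero_smul, add_zero])
      (e := Fintype.card F / 4) (K := _) le_rfl (by
        have e1 : q < 4 * (((Fintype.card F / 4 : ℕ) : ℝ) + 1) := by
          rw [hq]
          exact_mod_cast (by omega : Fintype.card F < 4 * (Fintype.card F / 4 + 1))
        rw [← Nat.cast_lt (α := ℝ)]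
        push_cast
        nlinarith)
      (by have := Fintype.card_pos (α := F); omega)
    have hb' : (b : ℝ) ≤ q / 16 + d := by
      rw [← Nat.cast_le (α := ℝ)] at hb
      push_cast at hb
      rw [← hq] at hb
      have : (b : ℝ) * q ≤ (q / 16 + d) * q := by
        refine hb.trans ((add_le_add (add_le_add g1 g2) le_rfl).trans (le_of_eq ?_))
        ring
      exact le_of_mul_le_mul_right this hq0
    have e1 := hQc s₀ (by
      rw [← Nat.cast_lt (α := ℝ)]
      push_cast
      rw [← hq]
      linarith) 0
    have e3 := hQ1 0
    simp only [zero_smul, add_zero] at e1 e3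
    refine ⟨fun s => Q s 0, hQr 0, e1.symm.trans g5, ?_⟩
    have e4 := cnt_ne_triangle (fun s => Q s 0) (fun s => G (x + s • D) (h2 + s • v'))
      (fun s => g (x + s • D))
    refine (Nat.cast_le.2 (e4.trans (add_le_add_left e3 _))).trans ?_
    push_cast
    linarith
  choose φ hφ hφg hφc using key
  -- Any two of them differ at no more than `q/4 + 2d < q - d` places, hence nowhere.
  have hall : ∀ s, φ s = φ 0 := fun s => by
    refine (hφ s).eq_of_cnt_lt (hφ 0) ?_
    have e1 := cnt_ne_triangle (φ s) (fun r => g (x + r • D)) (φ 0)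
    have e2 : cnt (fun r => g (x + r • D) ≠ φ 0 r) = cnt (fun r => φ 0 r ≠ g (x + r • D)) := by
      simp only [ne_comm]
    rw [e2] at e1
    have e3 : (cnt (fun r => φ s r ≠ φ 0 r) : ℝ) ≤ cnt (fun r => φ s r ≠ g (x + r • D)) +
        cnt (fun r => φ 0 r ≠ g (x + r • D)) := by exact_mod_cast e1
    have e4 := hφc s
    have e5 := hφc 0
    rw [← Nat.cast_lt (α := ℝ)]
    push_cast
    rw [← hq]
    linarith
  convert hφ 0 using 2 with s
  rw [← hφg s, hall s]

/-- If line polynomials rarely disagree with `f`, then most of them agree with a function that is a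
polynomial on every line. -/
theorem IsBestFit.exists_corrected {d : ℕ} {f : V → F} {G : V → V → F} {δ κ : ℝ}
    (h : IsBestFit d f G) (hδ0 : 0 ≤ δ)
    (hδ : cnt (fun x : V × V => G x.1 x.2 ≠ f x.1) ≤ δ * (Fintype.card V : ℝ) ^ 2)
    (hκ : κ = δ + 1 / Fintype.card F) (hsmall : κ ≤ 1 / 2 ^ 18)
    (hd : 512 * d ≤ Fintype.card F) :
    ∃ g : V → F, (∀ x D, IsPolyFun d fun s : F => g (x + s • D)) ∧
      ∀ x, (cnt fun D => G x D ≠ g x : ℝ) ≤ 2048 * κ * Fintype.card V := by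
  have hinc := h.cnt_inconsistent_le hδ0 hδ hd
  rw [← hκ] at hinc
  set q : ℝ := (Fintype.card F : ℝ) with hq
  set n : ℝ := (Fintype.card V : ℝ) with hn
  have hq0 : 0 < q := by rw [hq]; exact_mod_cast Fintype.card_pos
  have hn0 : 0 < n := by rw [hn]; exact_mod_cast Fintype.card_pos_iff.2 ⟨0⟩
  have hκ0 : 0 ≤ κ := by rw [hκ]; positivity
  have hpair : ∀ x, (cnt fun z : V × V => G x z.1 ≠ G x z.2 : ℝ) ≤ 2048 * κ * n ^ 2 := by
    intro x
    let τ : V × (V × V) ≃ (V × V) × V := (Equiv.prodAssoc V V V).symm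
    have e1 := cnt_comp_equiv τ (fun z : (V × V) × V => G x z.1.1 ≠ G x z.1.2)
    rw [cnt_fst (fun z : V × V => G x z.1 ≠ G x z.2)] at e1
    have e2 : cnt (fun w : V × (V × V) => G x (τ w).1.1 ≠ G x (τ w).1.2) ≤ _ :=
      cnt_mono (r := fun w : V × (V × V) => ¬ (G x w.1 = G x w.2.1 ∧
      128 * cnt (fun s : F => G (x + s • w.1) w.1 ≠ f (x + s • w.1)) ≤ Fintype.card F))
      fun w hw hc => hw hc.1
    rw [e1, ← Nat.cast_le (α := ℝ)] at e2
    push_cast at e2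
    rw [← hn] at e2
    refine le_of_mul_le_mul_left (e2.trans ((hinc x).trans (le_of_eq ?_))) hn0
    ring
  have hfar : ∀ x, (cnt fun D : V =>
      Fintype.card F < 128 * cnt (fun s : F => G (x + s • D) D ≠ f (x + s • D)) : ℝ) ≤
      2048 * κ * n := by
    intro x
    have e1 := cnt_fst (β := V × V) (fun D : V =>
      Fintype.card F < 128 * cnt (fun s : F => G (x + s • D) D ≠ f (x + s • D)))
    have e2 : cnt (fun w : V × (V × V) =>
      Fintype.card F < 128 * cnt (fun s : F => G (x + s • w.1) w.1 ≠ f (x + s • w.1))) ≤ _ :=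
      cnt_mono (r := fun w : V × (V × V) => ¬ (G x w.1 = G x w.2.1 ∧
      128 * cnt (fun s : F => G (x + s • w.1) w.1 ≠ f (x + s • w.1)) ≤ Fintype.card F))
      fun w hw hc => (not_lt.2 hc.2) hw
    rw [e1, ← Nat.cast_le (α := ℝ), Fintype.card_prod] at e2
    push_cast at e2
    rw [← hn] at e2
    refine le_of_mul_le_mul_left (e2.trans ((hinc x).trans (le_of_eq ?_))) (mul_pos hn0 hn0)
    ring
  have hne : Nonempty V := ⟨0⟩
  choose g hg using fun x => exists_popular (G x)
  have hg' : ∀ x, (cnt fun D => G x D ≠ g x : ℝ) ≤ 2048 * κ * n := by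
    intro x
    have e1 : n * (cnt fun D => G x D ≠ g x : ℝ) ≤ cnt fun z : V × V => G x z.1 ≠ G x z.2 := by
      rw [hn]
      exact_mod_cast hg x
    refine le_of_mul_le_mul_left (e1.trans ((hpair x).trans (le_of_eq ?_))) hn0
    ring
  refine ⟨g, fun x D => h.isPolyFun_corrected hδ0 hδ hκ (fun x => ?_) hg' (by linarith) hd x D, hg'⟩
  classical
  push_cast
  -- Lines near `f` contribute at most `1/128` each, and the others have density at most `2048 κ ≤
  -- 1/128`; together this is the required `1/64`.
  calc ∑ D : V, (cnt fun t : F => G (x + t • D) D ≠ f (x + t • D) : ℝ)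
      ≤ ∑ D : V, (q / 128 + q * if Fintype.card F <
          128 * cnt (fun s : F => G (x + s • D) D ≠ f (x + s • D)) then 1 else 0) := by
        refine Finset.sum_le_sum fun D _ => ?_
        split_ifs with hD
        · have : (cnt fun t : F => G (x + t • D) D ≠ f (x + t • D) : ℝ) ≤ q :=
            Nat.cast_le.2 (cnt_le_card _)
          linarith
        · have : 128 * (cnt fun t : F => G (x + t • D) D ≠ f (x + t • D) : ℝ) ≤ q := by
            rw [hq]
            exact_mod_cast not_lt.1 hD
          linarith
    _ = n * (q / 128) + q * cnt fun D : V =>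
          Fintype.card F < 128 * cnt (fun s : F => G (x + s • D) D ≠ f (x + s • D)) := by
        rw [Finset.sum_add_distrib, Finset.sum_const, Finset.card_univ, nsmul_eq_mul, ← hn,
          ← Finset.mul_sum, cnt_eq_sum]
    _ ≤ q * (1 / 64 * n) := by
        have e1 := hfar x
        have e2 : q * (cnt fun D : V => Fintype.card F <
          128 * cnt (fun s : F => G (x + s • D) D ≠ f (x + s • D)) : ℝ) ≤ q * (2048 * κ * n) :=
          mul_le_mul_of_nonneg_left e1 hq0.le
        have e3 : q * (2048 * κ * n) ≤ q * (1 / 128 * n) := by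
          gcongr
          linarith
        linarith

/-- Soundness of the point-line consistency test. -/
theorem IsBestFit.exists_close {d : ℕ} {f : V → F} {G : V → V → F} {ε : ℝ}
    (h : IsBestFit d f G) (hε : 0 < ε) (hε' : ε < 1 / 8)
    (hδ : cnt (fun x : V × V => G x.1 x.2 ≠ f x.1) ≤ (1 / 8 - ε) * (Fintype.card V : ℝ) ^ 2)
    (hq : 2 ^ 24 ≤ ε ^ 3 * Fintype.card F)
    (hd : 512 * d < ε * Fintype.card F) :
    ∃ g : V → F, (∀ x D, IsPolyFun d fun s : F => g (x + s • D)) ∧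
      (cnt fun y => f y ≠ g y : ℝ) ≤ 1 / 8 * Fintype.card V := by
  have hq0 : (0 : ℝ) < Fintype.card F := by exact_mod_cast Fintype.card_pos
  have hn0 : (0 : ℝ) < Fintype.card V := by exact_mod_cast Fintype.card_pos_iff.2 ⟨0⟩
  have hd0 : (0 : ℝ) ≤ d := Nat.cast_nonneg _
  have hpair := h.sum_cnt_ne_le hε hε' hδ (by linarith)
  have hdnat : 512 * d ≤ Fintype.card F := by
    rw [← Nat.cast_le (α := ℝ)]
    push_cast
    nlinarith
  have hne : Nonempty V := ⟨0⟩
  -- Majority decoding lowers the error from nearly `1/8` to `O(1/(ε² q))`. Since `G` is a best fit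
  -- to `f` and not to `f₁`, a new best fit `G₁` is needed before self-correction.
  choose f₁ hf₁ using fun x => exists_popular (G x)
  obtain ⟨G₁, hG₁⟩ := exists_bestFit (F := F) d f₁
  set q : ℝ := (Fintype.card F : ℝ)
  set n : ℝ := (Fintype.card V : ℝ) with hn
  set δ : ℝ := 16 / (ε ^ 2 * q) with hδdef
  have hδ0 : 0 ≤ δ := by positivity
  have hGf₁ : (cnt fun x : V × V => G x.1 x.2 ≠ f₁ x.1 : ℝ) ≤ δ * n ^ 2 := by
    have e1 : n * (cnt fun x : V × V => G x.1 x.2 ≠ f₁ x.1 : ℝ) ≤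
        (∑ y : V, cnt fun z : V × V => G y z.1 ≠ G y z.2 : ℕ) := by
      rw [cnt_prod, hn]
      have := Finset.sum_le_sum fun y (_ : y ∈ Finset.univ) => hf₁ y
      rw [← Finset.mul_sum] at this
      exact_mod_cast this
    rw [hδdef, div_mul_eq_mul_div, le_div_iff₀ (by positivity)]
    refine le_of_mul_le_mul_left (le_trans ?_ (hpair.trans (le_of_eq ?_))) hn0
    · rw [← mul_assoc]
      exact mul_le_mul_of_nonneg_right e1 (by positivity)
    · ring
  have hδ₁ : (cnt fun x : V × V => G₁ x.1 x.2 ≠ f₁ x.1 : ℝ) ≤ δ * n ^ 2 :=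
    (Nat.cast_le.2 (hG₁.cnt_le_of_isLineTable h.isLineTable)).trans hGf₁
  have hε2 : ε ^ 2 ≤ 1 := by nlinarith
  have hκε : δ + 1 / q ≤ ε / 2 ^ 18 := by
    have e1 : 1 / q ≤ 1 / (ε ^ 2 * q) := by
      apply one_div_le_one_div_of_le (by positivity)
      nlinarith
    have e2 : δ + 1 / q ≤ 17 / (ε ^ 2 * q) := by
      rw [hδdef]
      refine (add_le_add_right e1 _).trans (le_of_eq ?_)
      ring
    refine e2.trans ?_
    rw [div_le_iff₀ (by positivity)]
    linarith
  obtain ⟨g, hgpoly, hg⟩ := hG₁.exists_corrected hδ0 hδ₁ rfl (by linarith) hdnat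
  refine ⟨g, hgpoly, ?_⟩
  have hG₁g : (cnt fun x : V × V => G₁ x.1 x.2 ≠ g x.1 : ℝ) ≤ 2048 * (δ + 1 / q) * n ^ 2 := by
    rw [cnt_prod]
    push_cast
    calc _ ≤ ∑ y : V, 2048 * (δ + 1 / q) * n := Finset.sum_le_sum fun y _ => hg y
      _ = _ := by
          rw [Finset.sum_const, Finset.card_univ, nsmul_eq_mul, ← hn]
          ring
  have t1 := cnt_ne_triangle (fun x : V × V => f x.1) (fun x => G x.1 x.2) (fun x => g x.1)
  have t2 := cnt_ne_triangle (fun x : V × V => G x.1 x.2) (fun x => f₁ x.1) (fun x => g x.1)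
  have t3 := cnt_ne_triangle (fun x : V × V => f₁ x.1) (fun x => G₁ x.1 x.2) (fun x => g x.1)
  have c1 : cnt (fun x : V × V => f x.1 ≠ G x.1 x.2) = cnt (fun x : V × V => G x.1 x.2 ≠ f x.1) := by
    simp only [ne_comm]
  have c2 : cnt (fun x : V × V => f₁ x.1 ≠ G₁ x.1 x.2) =
      cnt (fun x : V × V => G₁ x.1 x.2 ≠ f₁ x.1) := by
    simp only [ne_comm]
  -- The chain is `f`, `G`, `f₁`, `G₁`, `g`; every link after the first is tiny, and together they
  -- use up at most the slack `ε`.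
  have t4 : cnt (fun x : V × V => f x.1 ≠ g x.1) ≤
      cnt (fun x : V × V => G x.1 x.2 ≠ f x.1) + (cnt (fun x : V × V => G x.1 x.2 ≠ f₁ x.1) +
      (cnt (fun x : V × V => G₁ x.1 x.2 ≠ f₁ x.1) + cnt (fun x : V × V => G₁ x.1 x.2 ≠ g x.1))) := by
    omega
  rw [cnt_fst (fun y => f y ≠ g y), ← Nat.cast_le (α := ℝ)] at t4
  push_cast at t4
  rw [← hn] at t4
  have hδε : δ ≤ ε / 2 ^ 18 := by
    have : 0 ≤ 1 / q := by positivity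
    linarith
  refine le_of_mul_le_mul_left (t4.trans ?_) hn0
  have hn2 : 0 < n ^ 2 := by positivity
  nlinarith

end SelfCorrection
end PolyLine

namespace PolyLine

open Polynomial Polynomial.Bivariate

/-! ### Functions that are polynomials on every line -/

section LineCharacterization

variable {F : Type u} [Field F] [Fintype F]

/-- A polynomial of low degree in each variable that has degree at most `d` on every line through
a point has total degree at most `d`. -/
theorem coeff_coeff_eq_zero_of_line {d : ℕ} (hd : 2 * d < Fintype.card F) {N : F[X][Y]}
    (hN : N.natDegree ≤ d) (hNs : (swap N).natDegree ≤ d)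
    (hline : ∀ α : F, IsPolyFun d fun s => N.evalEval s (α * s)) {i j : ℕ} (hij : d < i + j) :
    (N.coeff j).coeff i = 0 := by
  classical
  have hcoeff : ∀ (α : F) (k : ℕ), (N.eval (C α * X)).coeff k =
      ∑ j ∈ Finset.range (d + 1), (if j ≤ k then (N.coeff j).coeff (k - j) else 0) * α ^ j := by
    intro α k
    rw [eval_eq_sum_range' (Nat.lt_succ_of_le hN), finsetSum_coeff]
    refine Finset.sum_congr rfl fun j _ => ?_
    rw [mul_pow, ← C_pow, ← mul_assoc, mul_comm _ (C _), mul_assoc, coeff_C_mul, coeff_mul_X_pow']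
    ring
  have hz : ∀ {i j : ℕ}, d < i → (N.coeff j).coeff i = 0 := fun h =>
    coeff_eq_zero_of_natDegree_lt ((natDegree_swap_le_iff.1 hNs _).trans_lt h)
  have hzero : ∀ α : F, (N.eval (C α * X)).coeff (i + j) = 0 := by
    intro α
    obtain ⟨p, hp, hpe⟩ := hline α
    have hdeg : (N.eval (C α * X)).natDegree ≤ 2 * d := by
      rw [natDegree_le_iff_coeff_eq_zero]
      intro k hk
      rw [hcoeff]
      refine Finset.sum_eq_zero fun j hj => ?_
      have := Finset.mem_range.1 hj
      rw [hz (by omega), ite_self, zero_mul]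
    have : N.eval (C α * X) = p := by
      refine eq_of_card_lt_of_eval_eq hdeg (hp.trans (by omega)) ?_
      rw [Finset.filter_true_of_mem, Finset.card_univ]
      · exact hd
      · intro s _
        rw [hpe, ← coe_evalRingHom, ← Polynomial.eval₂_hom, coe_evalRingHom, eval₂_evalRingHom]
        simp
    rw [this, coeff_eq_zero_of_natDegree_lt (hp.trans_lt hij)]
  by_cases hj : d < j
  · rw [coeff_eq_zero_of_natDegree_lt (hN.trans_lt hj), coeff_zero]
  -- `T` is the coefficient of `s ^ (i + j)` in `N(s, α s)`, as a polynomial in the slope `α`. It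
  -- vanishes for all slopes and has degree at most `d < |F|`, so each of its coefficients is zero.
  let T : F[X] := ∑ l ∈ Finset.range (d + 1),
    C (if l ≤ i + j then (N.coeff l).coeff (i + j - l) else 0) * X ^ l
  have hT : T = 0 := by
    refine eq_zero_of_natDegree_lt_card_of_eval_eq_zero' _ Finset.univ (fun α _ => ?_) ?_
    · rw [← hzero α, hcoeff, eval_finsetSum]
      simp
    · refine lt_of_le_of_lt (natDegree_sum_le_of_forall_le (n := d) _ _ fun l hl => ?_)
        (by rw [Finset.card_univ]; omega)
      have := Finset.mem_range.1 hl
      exact (natDegree_C_mul_X_pow_le _ _).trans (by omega)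
  have := congrArg (fun p => p.coeff j) hT
  simp only [T, finsetSum_coeff, coeff_C_mul_X_pow, coeff_zero] at this
  rw [Finset.sum_eq_single j] at this
  · simpa using this
  · intro l _ hl
    rw [if_neg hl.symm]
  · intro h
    exact absurd (Finset.mem_range.2 (by omega)) h

/-- A function on `F^m` that is a polynomial of degree at most `d` on every line is a polynomial of
total degree at most `d`. -/
theorem exists_mvPolynomial_of_line {m d : ℕ} (hd : 2 * d < Fintype.card F)
    (g : (Fin m → F) → F) (hg : ∀ x D, IsPolyFun d fun s : F => g (x + s • D)) :
    ∃ p : MvPolynomial (Fin m) F, p.totalDegree ≤ d ∧ ∀ x, MvPolynomial.eval x p = g x := by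
  classical
  induction m generalizing d with
  | zero =>
    exact ⟨MvPolynomial.C (g 0), by simp, fun x => by simp [Subsingleton.elim x 0]⟩
  | succ m ih =>
    have hcol : ∀ x : Fin m → F, IsPolyFun d fun z : F => g (Fin.cons z x) := by
      intro x
      have := hg (Fin.cons 0 x) (Fin.cons 1 0)
      convert this using 3 with z
      funext i
      refine Fin.cases ?_ (fun i => ?_) i <;> simp
    choose P hP hPe using hcol
    -- Expand `g` in powers of the first coordinate. For the induction, the `j`-th coefficient must
    -- have degree `d - j` on lines; this is the total degree bound on the plane spanned by the line
    -- and the first coordinate axis.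
    have hcoeff : ∀ j ≤ d, ∀ x D, IsPolyFun (d - j) fun s : F => (P (x + s • D)).coeff j := by
      intro j hj x D
      have hrow : ∀ z : F, IsPolyFun d fun s : F => g (Fin.cons z (x + s • D)) := by
        intro z
        have := hg (Fin.cons z x) (Fin.cons 0 D)
        convert this using 3 with s
        funext i
        refine Fin.cases ?_ (fun i => ?_) i <;> simp
      choose R hR hRe using hrow
      obtain ⟨N, hN, hNs, hNe⟩ := exists_interpolant (k := d) (l := d) (by omega) (by omega)
        (fun s => P (x + s • D)) R (fun s => hP _) hR (fun s z => by rw [hPe, hRe])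
      refine ⟨N.coeff j, ?_, fun s => ?_⟩
      · rw [natDegree_le_iff_coeff_eq_zero]
        intro i hi
        refine coeff_coeff_eq_zero_of_line hd hN hNs (fun α => ?_) (by omega)
        have := hg (Fin.cons 0 x) (Fin.cons α D)
        convert this using 2 with s
        rw [← eval_slice, hNe, hPe]
        refine congrArg g ?_
        funext i
        refine Fin.cases ?_ (fun i => ?_) i
        · simp [mul_comm]
        · simp
      · change _ = (P (x + s • D)).coeff j
        rw [← hNe s, slice, coeff_map, coe_evalRingHom]
    have hex : ∀ j : ℕ, ∃ p : MvPolynomial (Fin m) F, j ≤ d →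
        p.totalDegree ≤ d - j ∧ ∀ x, MvPolynomial.eval x p = (P x).coeff j := by
      intro j
      by_cases hj : j ≤ d
      · obtain ⟨p, hp⟩ := ih (d := d - j) (by omega) (fun x => (P x).coeff j) (hcoeff j hj)
        exact ⟨p, fun _ => hp⟩
      · exact ⟨0, fun h => absurd h hj⟩
    choose p hp using hex
    refine ⟨∑ j ∈ Finset.range (d + 1), MvPolynomial.rename Fin.succ (p j) *
      MvPolynomial.X 0 ^ j, ?_, fun x => ?_⟩
    · refine MvPolynomial.totalDegree_finsetSum_le fun j hj => ?_
      have hj' : j ≤ d := Nat.lt_succ_iff.1 (Finset.mem_range.1 hj)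
      refine (MvPolynomial.totalDegree_mul _ _).trans ?_
      have h1 := (MvPolynomial.totalDegree_rename_le Fin.succ (p j)).trans (hp j hj').1
      have h2 := MvPolynomial.totalDegree_X_pow (R := F) (0 : Fin (m + 1)) j
      omega
    · have h1 : g x = (P (Fin.tail x)).eval (x 0) := by
        rw [hPe]
        exact congrArg g (Fin.cons_self_tail x).symm
      rw [h1, eval_eq_sum_range' (Nat.lt_succ_of_le (hP _)), map_sum]
      refine Finset.sum_congr rfl fun j hj => ?_
      have hj' : j ≤ d := Nat.lt_succ_iff.1 (Finset.mem_range.1 hj)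
      rw [map_mul, map_pow, MvPolynomial.eval_X, MvPolynomial.eval_rename, ← (hp j hj').2]
      rfl

end LineCharacterization
end PolyLine

namespace PolyLine

/-! ### Sampling -/

section Sampling

theorem map_uniformOfFintype_equiv {α β : Type*} [Fintype α] [Nonempty α] [Fintype β] [Nonempty β]
    (e : α ≃ β) : (PMF.uniformOfFintype α).map e = PMF.uniformOfFintype β := by
  classical
  ext b
  rw [PMF.map_apply, tsum_eq_single (e.symm b)]
  · simp [Fintype.card_congr e]
  · intro a ha
    rw [if_neg]
    rintro rfl
    simp at ha

theorem uniformOfFintype_prod (α β : Type*) [Fintype α] [Nonempty α] [Fintype β] [Nonempty β] :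
    (PMF.uniformOfFintype α).bind (fun a => (PMF.uniformOfFintype β).map fun b => (a, b)) =
      PMF.uniformOfFintype (α × β) := by
  classical
  ext ⟨a, b⟩
  rw [PMF.bind_apply, tsum_eq_single a]
  · rw [PMF.map_apply, tsum_eq_single b]
    · simp only [if_true, PMF.uniformOfFintype_apply, Fintype.card_prod, Nat.cast_mul]
      rw [ENNReal.mul_inv (Or.inr (ENNReal.natCast_ne_top _)) (Or.inl (ENNReal.natCast_ne_top _))]
    · intro b' hb
      rw [if_neg]
      intro h
      exact hb (Prod.ext_iff.1 h).2.symm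
  · intro a' ha
    rw [PMF.map_apply, ENNReal.tsum_eq_zero.2, mul_zero]
    intro b'
    rw [if_neg]
    intro h
    exact ha (Prod.ext_iff.1 h).1.symm

variable {F : Type u} [Field F] [Fintype F]

theorem runSampler_draw (k : ℕ) (mem : List F) :
    runSampler (List.replicate k .draw) mem =
      (PMF.uniformOfFintype (Fin k → F)).map fun v => (List.ofFn v).reverse ++ mem := by
  induction k generalizing mem with
  | zero =>
    rw [List.replicate_zero, runSampler]
    exact (PMF.map_const _ _).symm
  | succ k ih =>
    rw [List.replicate_succ, runSampler, SampleStep.exec, PMF.bind_map]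
    rw [← map_uniformOfFintype_equiv (Fin.consEquiv fun _ : Fin (k + 1) => F),
      ← uniformOfFintype_prod, PMF.map_comp, PMF.map_bind]
    congr 1
    funext a
    rw [Function.comp_apply, ih, PMF.map_comp]
    congr 1
    funext v
    simp [Fin.consEquiv, List.ofFn_succ]

theorem map_runSampler_draw (k : ℕ) :
    ((runSampler (List.replicate k .draw) []).map fun (mem : List F) (j : Fin k) =>
      mem.getD j 0) = PMF.uniformOfFintype (Fin k → F) := by
  rw [runSampler_draw, PMF.map_comp]
  -- Each draw is written in front of the memory, so the vector is read back in reverse order;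
  -- reversal preserves the uniform distribution.
  refine Eq.trans ?_
    (map_uniformOfFintype_equiv (Equiv.arrowCongr (Fin.revPerm (n := k)) (Equiv.refl F)))
  congr 1
  funext v j
  have hj := j.2
  simp only [Function.comp_apply, List.append_nil, Equiv.arrowCongr_apply, Equiv.coe_refl,
    id_eq, Fin.revPerm_symm, Fin.revPerm_apply]
  rw [List.getD_eq_getElem _ _ (by simp), List.getElem_reverse]
  simp only [List.length_ofFn, List.getElem_ofFn]
  congr 1
  ext
  simp
  omega

theorem isSampledIn_uniform {Ω : Type u} [Fintype Ω] [Nonempty Ω] {k : ℕ} (e : Ω ≃ (Fin k → F)) :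
    IsSampledIn F k (PMF.uniformOfFintype Ω) := by
  refine ⟨List.replicate k .draw, k, fun j => j, e, by simp, e.injective, ?_⟩
  rw [map_uniformOfFintype_equiv, map_runSampler_draw]

/-- The points `x`, `h` and the parameter `t` as a vector with `2 m + 1` entries. -/
noncomputable def linesTestEncoding (m : ℕ) (F : Type u) :
    (Fin m → F) × (Fin m → F) × F ≃ (Fin (2 * m + 1) → F) :=
  calc (Fin m → F) × (Fin m → F) × F
      ≃ (Fin m → F) × (Fin m → F) × (Fin 1 → F) :=
        Equiv.prodCongr (Equiv.refl _) (Equiv.prodCongr (Equiv.refl _)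
          (Equiv.funUnique (Fin 1) F).symm)
    _ ≃ (Fin m → F) × (Fin m ⊕ Fin 1 → F) :=
        Equiv.prodCongr (Equiv.refl _) (Equiv.sumArrowEquivProdArrow _ _ _).symm
    _ ≃ (Fin m ⊕ (Fin m ⊕ Fin 1) → F) := (Equiv.sumArrowEquivProdArrow _ _ _).symm
    _ ≃ (Fin (2 * m + 1) → F) := Equiv.arrowCongr
        (Fintype.equivFinOfCardEq (by simp only [Fintype.card_sum, Fintype.card_fin]; ring))
        (Equiv.refl F)

theorem isSampledIn_linesTest (m d : ℕ) : IsSampledIn F (2 * m + 1) (linesTest m d F).μ :=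
  isSampledIn_uniform (Ω := (Fin m → F) × (Fin m → F) × F) (linesTestEncoding m F)

theorem map_uniformOfFintype_apply {Ω β : Type*} [Fintype Ω] [Nonempty Ω] (φ : Ω → β) (b : β) :
    ((PMF.uniformOfFintype Ω).map φ) b =
      ENNReal.ofReal ((cnt fun a => φ a = b : ℝ) / Fintype.card Ω) := by
  classical
  have hc : (0 : ℝ) < Fintype.card Ω := by exact_mod_cast Fintype.card_pos
  rw [PMF.map_apply, tsum_fintype, ENNReal.ofReal_div_of_pos hc, ENNReal.ofReal_natCast,
    ENNReal.ofReal_natCast, cnt_eq_sum_nat]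
  push_cast
  rw [div_eq_mul_inv, Finset.sum_mul]
  refine Finset.sum_congr rfl fun a _ => ?_
  simp only [PMF.uniformOfFintype_apply, eq_comm (a := b), ite_mul, one_mul, zero_mul]

end Sampling

/-! ### The polynomial-line code -/

section Code

open Polynomial

variable {F : Type u} [Field F]

theorem isPolyFun_coeffEval {d : ℕ} (a : Fin (d + 1) → F) : IsPolyFun d (coeffEval a) := by
  refine ⟨∑ i : Fin (d + 1), C (a i) * X ^ (i : ℕ), ?_, fun t => ?_⟩
  · exact natDegree_sum_le_of_forall_le _ _ fun i _ =>
      (natDegree_C_mul_X_pow_le _ _).trans (Nat.lt_succ_iff.1 i.2)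
  · simp [coeffEval, eval_finsetSum]

theorem IsPolyFun.exists_coeffEval {d : ℕ} {φ : F → F} (h : IsPolyFun d φ) :
    ∃ a : Fin (d + 1) → F, ∀ t, coeffEval a t = φ t := by
  obtain ⟨p, hp, hpe⟩ := h
  refine ⟨fun i => p.coeff i, fun t => ?_⟩
  rw [← hpe, eval_eq_sum_range' (Nat.lt_succ_of_le hp), coeffEval,
    Fin.sum_univ_eq_sum_range (fun i => p.coeff i * t ^ i)]

theorem coeffEval_injective [Fintype F] {d : ℕ} (hd : d < Fintype.card F) :
    Function.Injective (coeffEval (F := F) (d := d)) := by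
  intro a b h
  have h1 : (∑ i : Fin (d + 1), C (a i - b i) * X ^ (i : ℕ) : F[X]) = 0 := by
    refine eq_zero_of_natDegree_lt_card_of_eval_eq_zero' _ Finset.univ (fun t _ => ?_)
      (lt_of_le_of_lt (natDegree_sum_le_of_forall_le (n := d) _ _ fun i _ =>
        (natDegree_C_mul_X_pow_le _ _).trans (Nat.lt_succ_iff.1 i.2))
        (by rwa [Finset.card_univ]))
    have := congrFun h t
    simp only [coeffEval] at this
    simp [eval_finsetSum, sub_mul, this]
  funext i
  have h2 := congrArg (fun p => p.coeff (i : ℕ)) h1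
  simp only [finsetSum_coeff, coeff_C_mul_X_pow, coeff_zero] at h2
  rw [Finset.sum_eq_single i (fun j _ hj => if_neg fun hij => hj (Fin.ext hij.symm))
    (by simp), if_pos rfl, sub_eq_zero] at h2
  exact h2

theorem isPolyFun_eval_line {m d : ℕ} {p : MvPolynomial (Fin m) F} (hp : p.totalDegree ≤ d)
    (x h : Fin m → F) : IsPolyFun d fun t => MvPolynomial.eval (x + t • h) p := by
  refine ⟨MvPolynomial.aeval (fun i => C (x i) + C (h i) * X) p, ?_, fun t => ?_⟩
  · refine (MvPolynomial.aeval_natDegree_le p hp _ (n := 1) fun i => ?_).trans (by omega)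
    rw [add_comm]
    exact natDegree_linear_le
  · rw [← coe_evalRingHom, MvPolynomial.aeval_def, MvPolynomial.hom_eval₂]
    change _ = MvPolynomial.eval₂ (RingHom.id F) (x + t • h) p
    congr 1
    · ext; simp
    · funext i
      simp only [coe_evalRingHom, eval_add, eval_C, eval_mul, eval_X, Pi.add_apply, Pi.smul_apply,
        smul_eq_mul, mul_comm t]

variable [Fintype F]

/-- Full agreement is attainable, so every maximiser attains it and the tie-breaking does not
matter. -/
theorem coeffEval_linePoly {m d : ℕ} {f : (Fin m → F) → F} {x h : Fin m → F}
    (hf : IsPolyFun d fun t => f (x + t • h)) (t : F) :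
    coeffEval (linePoly d f x h) t = f (x + t • h) := by
  classical
  obtain ⟨a, ha⟩ := hf.exists_coeffEval
  have h1 : agreement f x h a ≤ agreement f x h (linePoly d f x h) :=
    Classical.choose_spec (Finite.exists_max (agreement (d := d) f x h)) a
  have h2 : agreement f x h a = Fintype.card F := by
    rw [agreement, Finset.filter_true_of_mem fun t _ => ha t, Finset.card_univ]
  have h3 : (Finset.univ.filter fun t : F => coeffEval (linePoly d f x h) t = f (x + t • h)) =
      Finset.univ := by
    rw [← Finset.card_eq_iff_eq_univ]
    refine le_antisymm (Finset.card_le_univ _) ?_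
    rw [h2] at h1
    refine h1.trans (le_of_eq ?_)
    unfold agreement
    congr!
  have h4 := Finset.mem_univ t
  rw [← h3] at h4
  exact (Finset.mem_filter.1 h4).2

theorem coeffEval_polyLineCode {m d : ℕ} (p : MvPolynomial.restrictTotalDegree (Fin m) F d)
    (i : (Fin m → F) × (Fin m → F)) (t : F) :
    coeffEval (polyLineCode m d F p i) t = MvPolynomial.eval (i.1 + t • i.2) p.1 :=
  coeffEval_linePoly (f := fun y => MvPolynomial.eval y p.1) (isPolyFun_eval_line
    ((MvPolynomial.mem_restrictTotalDegree _ _ _).1 p.2) i.1 i.2) t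

theorem hammingDist_eq_cnt {ι A : Type*} [Fintype ι] [DecidableEq A] (w v : ι → A) :
    hammingDist w v = cnt fun i => w i ≠ v i := by
  unfold hammingDist cnt
  congr!

theorem card_mul_cnt_eval_eq_le {m d : ℕ} {p r : MvPolynomial (Fin m) F} (hp : p.totalDegree ≤ d)
    (hr : r.totalDegree ≤ d) (hne : p ≠ r) :
    Fintype.card F * cnt (fun x => MvPolynomial.eval x p = MvPolynomial.eval x r) ≤
      d * Fintype.card (Fin m → F) := by
  classical
  have hq : (0 : ℚ≥0) < Fintype.card F := by exact_mod_cast Fintype.card_pos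
  have h1 := MvPolynomial.schwartz_zippel_totalDegree (sub_ne_zero.2 hne) (Finset.univ : Finset F)
  rw [Finset.card_univ, div_le_div_iff₀ (by positivity) hq] at h1
  have h2 : (p - r).totalDegree ≤ d := (MvPolynomial.totalDegree_sub _ _).trans (max_le hp hr)
  have h3 : (Finset.filter (fun f => MvPolynomial.eval f (p - r) = 0)
      (Fintype.piFinset fun _ => (Finset.univ : Finset F))).card =
      cnt (fun x => MvPolynomial.eval x p = MvPolynomial.eval x r) := by
    unfold cnt
    rw [Fintype.piFinset_univ]
    simp only [map_sub, sub_eq_zero]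
  rw [h3] at h1
  have h4 : cnt (fun x => MvPolynomial.eval x p = MvPolynomial.eval x r) * Fintype.card F ≤
      (p - r).totalDegree * Fintype.card F ^ m := by exact_mod_cast h1
  rw [Fintype.card_fun, Fintype.card_fin, mul_comm]
  exact h4.trans (Nat.mul_le_mul_right _ h2)

/-- Equal letters at `(x, h)` have equal values at `t = 0`, so the two polynomials agree at `x`;
Schwartz–Zippel bounds the number of such `x`. -/
theorem le_hammingDist_polyLineCode {m d : ℕ} [DecidableEq (Fin (d + 1) → F)]
    {a b : MvPolynomial.restrictTotalDegree (Fin m) F d} (hab : a ≠ b) :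
    (Fintype.card F - d : ℝ) * (Fintype.card (Fin m → F) : ℝ) ^ 2 ≤
      Fintype.card F * hammingDist (polyLineCode m d F a) (polyLineCode m d F b) := by
  have h1 : cnt (fun i => polyLineCode m d F a i = polyLineCode m d F b i) ≤
      cnt (fun i : (Fin m → F) × (Fin m → F) =>
        MvPolynomial.eval i.1 a.1 = MvPolynomial.eval i.1 b.1) := by
    refine cnt_mono fun i hi => ?_
    have := congrArg (fun c => coeffEval c 0) hi
    simpa only [coeffEval_polyLineCode, zero_smul, add_zero] using this
  rw [cnt_fst (fun x => MvPolynomial.eval x a.1 = MvPolynomial.eval x b.1)] at h1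
  have h2 := card_mul_cnt_eval_eq_le ((MvPolynomial.mem_restrictTotalDegree _ _ _).1 a.2)
    ((MvPolynomial.mem_restrictTotalDegree _ _ _).1 b.2) (fun h => hab (Subtype.ext h))
  have h3 := cnt_add_cnt_not (fun i => polyLineCode m d F a i = polyLineCode m d F b i)
  rw [← hammingDist_eq_cnt, Fintype.card_prod] at h3
  set n := Fintype.card (Fin m → F)
  set q := Fintype.card F
  have h4 : q * cnt (fun i => polyLineCode m d F a i = polyLineCode m d F b i) ≤ d * n ^ 2 := by
    calc _ ≤ q * (n * cnt fun x => MvPolynomial.eval x a.1 = MvPolynomial.eval x b.1) :=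
          Nat.mul_le_mul_left _ h1
      _ = n * (q * cnt fun x => MvPolynomial.eval x a.1 = MvPolynomial.eval x b.1) := by ring
      _ ≤ n * (d * n) := Nat.mul_le_mul_left _ h2
      _ = _ := by ring
  have h5 : (q : ℝ) * cnt (fun i => polyLineCode m d F a i = polyLineCode m d F b i) ≤
      d * (n : ℝ) ^ 2 := by exact_mod_cast h4
  have h6 : (cnt (fun i => polyLineCode m d F a i = polyLineCode m d F b i) : ℝ) +
      hammingDist (polyLineCode m d F a) (polyLineCode m d F b) = (n : ℝ) * n := by
    exact_mod_cast h3
  have h7 : (hammingDist (polyLineCode m d F a) (polyLineCode m d F b) : ℝ) =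
      n * n - cnt (fun i => polyLineCode m d F a i = polyLineCode m d F b i) := by linarith
  rw [h7]
  linarith

theorem le_minDist_polyLineCode (m d : ℕ) [DecidableEq (Fin (d + 1) → F)] :
    (Fintype.card F - d : ℝ) * (Fintype.card (Fin m → F) : ℝ) ^ 2 ≤
      Fintype.card F * minDist (polyLineCode m d F) := by
  -- The infimum of the empty set would be `0`; the messages `0` and `1` show that the set of
  -- distances is nonempty.
  have hmem : minDist (polyLineCode m d F) ∈ _ := Nat.sInf_mem
    (s := {k | ∃ a b, a ≠ b ∧
      hammingDist (polyLineCode m d F a) (polyLineCode m d F b) = k})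
    ⟨_, 0, ⟨1, (MvPolynomial.mem_restrictTotalDegree _ _ _).2 (by simp)⟩,
      fun h => zero_ne_one (congrArg Subtype.val h), rfl⟩
  obtain ⟨a, b, hab, hk⟩ := hmem
  rw [← hk]
  exact le_hammingDist_polyLineCode hab

theorem eq_of_hammingDist_lt_minDist {M ι A : Type*} [Fintype ι] [DecidableEq A] {C : M → ι → A} {w : ι → A}
    {a b : M} (ha : (hammingDist w (C a) : ℝ) < (minDist C : ℝ) / 2)
    (hb : (hammingDist w (C b) : ℝ) < (minDist C : ℝ) / 2) : a = b := by
  by_contra hab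
  have h1 : minDist C ≤ hammingDist (C a) (C b) := Nat.sInf_le ⟨a, b, hab, rfl⟩
  have h2 := hammingDist_triangle_left (C a) (C b) w
  have h3 : (minDist C : ℝ) ≤ hammingDist w (C a) + hammingDist w (C b) := by
    exact_mod_cast h1.trans h2
  linarith

/-- A word that passes the lines test with the table and the point values close to a polynomial is
close to the codeword of that polynomial. -/
theorem hammingDist_polyLineCode_le {m d : ℕ} [DecidableEq (Fin (d + 1) → F)]
    (hd : d < Fintype.card F)
    (w : (Fin m → F) × (Fin m → F) → Fin (d + 1) → F) (f : (Fin m → F) → F)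
    (p : MvPolynomial.restrictTotalDegree (Fin m) F d) {ρ β : ℝ}
    (hw : ((∑ x : (Fin m → F) × (Fin m → F),
      cnt fun t : F => coeffEval (w x) t ≠ f (x.1 + t • x.2) : ℕ) : ℝ) ≤
        ρ * (Fintype.card F * (Fintype.card (Fin m → F) : ℝ) ^ 2))
    (hf : (cnt fun y => f y ≠ MvPolynomial.eval y p.1 : ℝ) ≤ β * Fintype.card (Fin m → F)) :
    hammingDist w (polyLineCode m d F p) * (Fintype.card F - d : ℝ) ≤
      (ρ + β) * (Fintype.card F * (Fintype.card (Fin m → F) : ℝ) ^ 2) := by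
  have h1 : ∀ x : (Fin m → F) × (Fin m → F),
      (if w x ≠ polyLineCode m d F p x then (Fintype.card F - d : ℝ) else 0) ≤
      (cnt fun t : F => coeffEval (w x) t ≠ f (x.1 + t • x.2) : ℝ) +
        cnt fun t : F => f (x.1 + t • x.2) ≠ MvPolynomial.eval (x.1 + t • x.2) p.1 := by
    intro x
    split_ifs with hx
    · have h2 := cnt_ne_triangle (coeffEval (w x)) (fun t => f (x.1 + t • x.2))
        (fun t => MvPolynomial.eval (x.1 + t • x.2) p.1)
      -- A wrong letter differs from the polynomial at `|F| - d` or more parameters, and each is an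
      -- error of `w` against `f` or of `f` against the polynomial.
      have h3 : Fintype.card F ≤ cnt (fun t => coeffEval (w x) t ≠
          MvPolynomial.eval (x.1 + t • x.2) p.1) + d := by
        by_contra! hlt
        refine hx (coeffEval_injective hd ?_)
        have := (isPolyFun_coeffEval (w x)).eq_of_cnt_lt (isPolyFun_eval_line
          ((MvPolynomial.mem_restrictTotalDegree _ _ _).1 p.2) x.1 x.2) hlt
        rw [this]
        funext t
        exact (coeffEval_polyLineCode p x t).symm
      have h4 : (Fintype.card F : ℝ) ≤ (cnt fun t : F => coeffEval (w x) t ≠ f (x.1 + t • x.2)) +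
        (cnt fun t : F => f (x.1 + t • x.2) ≠ MvPolynomial.eval (x.1 + t • x.2) p.1) + d := by
        exact_mod_cast h3.trans (Nat.add_le_add_right h2 d)
      linarith
    · positivity
  have h2 := Finset.sum_le_sum fun x (_ : x ∈ Finset.univ) => h1 x
  have h3 := sum_cnt_line (F := F)
    (fun (y : Fin m → F) (_ : Fin m → F) => f y ≠ MvPolynomial.eval y p.1)
  rw [cnt_fst (fun y => f y ≠ MvPolynomial.eval y p.1)] at h3
  rw [Finset.sum_add_distrib, ← Nat.cast_sum, ← Nat.cast_sum, h3] at h2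
  rw [hammingDist_eq_cnt, cnt_eq_sum, Finset.sum_mul]
  simp only [ite_mul, one_mul, zero_mul]
  refine h2.trans ?_
  push_cast at hw ⊢
  have h4 : (0 : ℝ) ≤ Fintype.card F * Fintype.card (Fin m → F) := by positivity
  have h5 := mul_le_mul_of_nonneg_left hf h4
  linarith

theorem linesTest_tests {m d : ℕ} {ε : ℝ} (hε : 0 < ε) (hε' : ε < 1 / 8)
    (hq : 2 ^ 24 ≤ ε ^ 3 * Fintype.card F) (hd : 512 * d < ε * Fintype.card F) :
    (linesTest m d F).Tests (polyLineCode m d F) (1 / 8 - ε) := by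
  let _ : DecidableEq (Fin (d + 1) → F) := fun a b => Classical.propDecidable (a = b)
  have hq0 : (0 : ℝ) < Fintype.card F := by exact_mod_cast Fintype.card_pos
  have hd0 : (0 : ℝ) ≤ d := Nat.cast_nonneg _
  have hdq : 4096 * (d : ℝ) < Fintype.card F := by nlinarith
  have hdq' : 4096 * d < Fintype.card F := by exact_mod_cast hdq
  constructor
  · rintro p ⟨x, h, t⟩
    simp [LocalTest.run, linesTest, coeffEval_polyLineCode]
  · intro w hw
    set n : ℝ := (Fintype.card (Fin m → F) : ℝ) with hn
    have hn0 : 0 < n := by rw [hn]; exact_mod_cast Fintype.card_pos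
    let f : (Fin m → F) → F := fun y => coeffEval (w (y, 0)) 0
    have hrej : ((∑ x : (Fin m → F) × (Fin m → F),
        cnt fun t : F => coeffEval (w x) t ≠ f (x.1 + t • x.2) : ℕ) : ℝ) ≤
        (1 / 8 - ε) * (Fintype.card F * n ^ 2) := by
      have h1 : (linesTest m d F).rejectProb w = _ := map_uniformOfFintype_apply
        (Ω := (Fin m → F) × (Fin m → F) × F) ((linesTest m d F).run w) false
      rw [h1, ENNReal.ofReal_lt_ofReal_iff (by linarith), div_lt_iff₀ (by positivity)] at hw
      have h2 : cnt (fun r : (Fin m → F) × (Fin m → F) × F =>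
          (linesTest m d F).run w r = false) = ∑ x : (Fin m → F) × (Fin m → F),
          cnt fun t : F => coeffEval (w x) t ≠ f (x.1 + t • x.2) := by
        rw [← cnt_prod (fun z : ((Fin m → F) × (Fin m → F)) × F =>
          coeffEval (w z.1) z.2 ≠ f (z.1.1 + z.2 • z.1.2)),
          ← cnt_comp_equiv (Equiv.prodAssoc _ _ _).symm]
        congr 1
        funext r
        simp [LocalTest.run, linesTest, f]
      rw [h2] at hw
      refine hw.le.trans (le_of_eq ?_)
      simp only [Fintype.card_prod]
      push_cast
      rw [← hn]
      ring
    obtain ⟨G, hG⟩ := exists_bestFit (F := F) d f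
    have hGf : (cnt (fun x : (Fin m → F) × (Fin m → F) => G x.1 x.2 ≠ f x.1) : ℝ) ≤
        (1 / 8 - ε) * n ^ 2 := by
      have h1 := hG.card_mul_cnt_le (fun x D => coeffEval (w (x, D)))
        (fun x D => isPolyFun_coeffEval _)
      rw [← Nat.cast_le (α := ℝ)] at h1
      have h2 := h1.trans hrej
      push_cast at h2
      refine le_of_mul_le_mul_left (h2.trans (le_of_eq ?_)) hq0
      ring
    obtain ⟨g, hg, hfg⟩ := hG.exists_close hε hε' hGf hq hd
    obtain ⟨p, hp, hpg⟩ := exists_mvPolynomial_of_line (by omega) g hg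
    let P : MvPolynomial.restrictTotalDegree (Fin m) F d :=
      ⟨p, (MvPolynomial.mem_restrictTotalDegree _ _ _).2 hp⟩
    have hdist := hammingDist_polyLineCode_le (by omega) w f P hrej (β := 1 / 8)
      (by simpa only [P, hpg] using hfg)
    have hmin := le_minDist_polyLineCode (F := F) m d
    rw [← hn] at hdist hmin
    have hlt : (hammingDist w (polyLineCode m d F P) : ℝ) <
        (minDist (polyLineCode m d F) : ℝ) / 2 := by
      have hn2 : 0 < n ^ 2 := by positivity
      set q : ℝ := (Fintype.card F : ℝ)
      -- As `d < q / 4096`, the distance `(1/4 - ε) q / (q - d)` is at most `1/3`, below half of the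
      -- relative minimum distance, which is at least `3/8`.
      have h1 : (hammingDist w (polyLineCode m d F P) : ℝ) ≤ 1 / 3 * n ^ 2 := by
        have h2 : (0 : ℝ) < q - d := by linarith
        refine le_of_mul_le_mul_right (hdist.trans ?_) h2
        nlinarith [mul_pos hq0 hn2, mul_pos hε (mul_pos hq0 hn2)]
      have h3 : 3 / 4 * n ^ 2 ≤ minDist (polyLineCode m d F) := by
        refine le_of_mul_le_mul_left (le_trans ?_ hmin) hq0
        nlinarith
      linarith
    exact ⟨P, hlt, fun b hb => eq_of_hammingDist_lt_minDist hb hlt⟩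

end Code

/-! ### Families -/

section Families

theorem _root_.IsPolyLineFamily.tendsto_degree {c₁ c₂ : ℝ} {d : ℕ → ℕ} {F : ℕ → Type u}
    [∀ m, Fintype (F m)] (h : IsPolyLineFamily c₁ c₂ d F) :
    Tendsto (fun m => (d m : ℝ)) atTop atTop := by
  have h1 : Tendsto (fun m : ℕ => (m : ℝ) ^ c₁) atTop atTop :=
    (tendsto_rpow_atTop (by linarith [h.one_lt_c₁])).comp tendsto_natCast_atTop_atTop
  have h2 := (h.degree.tendsto_norm_atTop_iff).2 (tendsto_norm_atTop_atTop.comp h1)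
  refine h2.congr fun m => ?_
  simp

/-- `|F|` is at least a constant times `d * d ^ (c₂ - 1)`, and the second factor tends to infinity
with `d`. -/
theorem _root_.IsPolyLineFamily.eventually_mul_le_card {c₁ c₂ : ℝ} {d : ℕ → ℕ} {F : ℕ → Type u}
    [∀ m, Fintype (F m)] (h : IsPolyLineFamily c₁ c₂ d F) (hc₂ : 1 < c₂) (c : ℝ) :
    ∀ᶠ m in atTop, c * d m ≤ Fintype.card (F m) := by
  obtain ⟨K, hK, hb⟩ := h.fieldSize.2.exists_pos
  have hd := h.tendsto_degree
  have h1 : Tendsto (fun m => (d m : ℝ) ^ (c₂ - 1)) atTop atTop :=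
    (tendsto_rpow_atTop (by linarith)).comp hd
  filter_upwards [hb.bound, h1.eventually_ge_atTop (K * c), hd.eventually_gt_atTop 0]
    with m hm1 hm2 hm3
  rw [Real.norm_of_nonneg (by positivity), Real.norm_of_nonneg (by positivity)] at hm1
  have h2 : (d m : ℝ) ^ c₂ = d m * (d m : ℝ) ^ (c₂ - 1) := by
    rw [← Real.rpow_one_add' hm3.le (by linarith)]
    ring_nf
  rw [h2] at hm1
  refine le_of_mul_le_mul_left (le_trans ?_ hm1) hK
  nlinarith

end Families

end PolyLine

/-! ### Choice of the constant and the two claims -/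

open PolyLine in
theorem mainTheorem4 (ε : ℝ) (hε : 0 < ε) (hε' : ε < 1 / 8) :
    ∃ c : ℝ, 0 < c ∧
      (∀ (m d : ℕ) (F : Type u) [Field F] [Fintype F], 1 ≤ m → 1 ≤ d →
        c * d ≤ Fintype.card F →
          IsSampledIn F (2 * m + 1) (linesTest m d F).μ ∧
          (linesTest m d F).Tests (polyLineCode m d F) (1 / 8 - ε) ∧
          IsLocallyTestable F 2 (1 / 8 - ε) (2 * m + 1) (polyLineCode m d F)) ∧
      (∀ (c₁ c₂ : ℝ) (d : ℕ → ℕ) (F : ℕ → Type u) [∀ m, Field (F m)] [∀ m, Fintype (F m)],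
        IsPolyLineFamily c₁ c₂ d F →
          (1 < c₂ ∨ ∀ᶠ m in atTop, c * d m ≤ Fintype.card (F m)) →
            ∀ᶠ m in atTop,
              IsLocallyTestable (F m) 2 (1 / 8 - ε) (2 * m + 1)
                (polyLineCode m (d m) (F m))) := by
  -- In `c = 2 ^ 24 / ε ^ 3`, two powers of `ε` pay for Chebyshev and the third for keeping the
  -- accumulated error below `ε`. Since `d ≥ 1` and `ε < 1`, this one bound gives both size
  -- conditions on `F`.
  have part1 : ∀ (m d : ℕ) (F : Type u) [Field F] [Fintype F], 1 ≤ d →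
      2 ^ 24 / ε ^ 3 * d ≤ Fintype.card F →
        IsSampledIn F (2 * m + 1) (linesTest m d F).μ ∧
        (linesTest m d F).Tests (polyLineCode m d F) (1 / 8 - ε) ∧
        IsLocallyTestable F 2 (1 / 8 - ε) (2 * m + 1) (polyLineCode m d F) := by
    intro m d F _ _ hd hc
    have hd' : (1 : ℝ) ≤ d := by exact_mod_cast hd
    have hε3 : 0 < ε ^ 3 := by positivity
    rw [div_mul_eq_mul_div, div_le_iff₀ hε3] at hc
    have hq0 : (0 : ℝ) < Fintype.card F := by exact_mod_cast Fintype.card_pos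
    have h1 : ε ^ 3 * Fintype.card F ≤ ε * Fintype.card F := by
      refine mul_le_mul_of_nonneg_right ?_ hq0.le
      calc ε ^ 3 ≤ ε ^ 1 := pow_le_pow_of_le_one hε.le (by linarith) (by norm_num)
        _ = ε := pow_one ε
    have ht : (linesTest m d F).Tests (polyLineCode m d F) (1 / 8 - ε) :=
      linesTest_tests hε hε' (by linarith) (by linarith)
    exact ⟨isSampledIn_linesTest m d, ht, two_pos, by linarith,
      linesTest m d F, isSampledIn_linesTest m d, ht⟩
  refine ⟨2 ^ 24 / ε ^ 3, by positivity, fun m d F _ _ _ hd hc => part1 m d F hd hc, ?_⟩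
  intro c₁ c₂ d F _ _ hfam hlarge
  have hc : ∀ᶠ m in atTop, 2 ^ 24 / ε ^ 3 * (d m : ℝ) ≤ Fintype.card (F m) :=
    hlarge.elim (fun h => hfam.eventually_mul_le_card h _) id
  filter_upwards [hc, hfam.tendsto_degree.eventually_ge_atTop 1] with m hm hdm
  exact (part1 m (d m) (F m) (by exact_mod_cast hdm) hm).2.2
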